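/- Let $r_0\ge 0$, $p_0>0$, $p,q>0$ with $p+q=1$, $q_0:=1-r_0-p_0>0$ and $p\le 1/2$. Consider the random walk on $\{-1,0,1,2,\dots\}$ in which $-1$ is absorbing, from $0$ the walk stays at $0$ with probability $r_0$, moves to $1$ with probability $p_0$ and to $-1$ with probability $q_0$, and from $i\ge 1$ it moves to $i+1$ with probability $p$ and to $i-1$ with probability $q$. Let $\mathbb P$ be the (substochastic) transition matrix restricted to $\{0,1,2,\dots\}$. For an initial distribution on $\{0,1,2,\dots\}$ let $p_j(n)$ be the probability that the walk is at $j$ at time $n$. A probability distribution $\alpha=(\alpha_j)_{j\ge0}$ on $\{0,1,2,\dots\}$ is called quasi-stationary if, for the walk with $p_j(0)=\alpha_j$, one has $p_{-1}(n)<1$ and $p_j(n)/(1-p_{-1}(n))=\alpha_j$ for all $j\ge 0$, $n\ge 0$. Put $\pi_0=1$, $\pi_j=p_0p^{j-1}/q^j$ for $j\ge1$, and $$Q_j(x)=\Big(\frac qp\Big)^{j/2}\Big[\frac{2(p_0-p)}{p_0}T_j(x^*)+\frac{2p-p_0}{p_0}U_j(x^*)-\frac{r_0}{p_0}\sqrt{\frac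 pq}\,U_{j-1}(x^*)\Big],\qquad x^*=\frac{x}{2\sqrt{pq}},$$ where $T_j,U_j$ are the Chebyshev polynomials of the first and second kind and $U_{-1}=0$. Then: 1. Absorption is certain: for every initial distribution on $\{0,1,2,\dots\}$, $p_{-1}(n)\to1$ as $n\to\infty$. 2. For every real $x$, $Q_0(x)=1$ and $\mathbb P\,Q(x)=x\,Q(x)$, where $Q(x)=(Q_0(x),Q_1(x),\dots)^{T}$. 3. There is exactly one measure $\psi$ supported in $[-1,1]$ with $\pi_j\int Q_iQ_j\,d\psi=\delta_{ij}$ for all $i,j\ge 0$. Let $\eta$ be the supremum of the support of $\psi$. 4. If $p=1/2$, then $\eta=1$ and there is no quasi-stationary distribution. 5. If $p<1/2$, then $\eta<1$, and for every $x$ with $\eta<x<1$ $$\alpha_j(x)=\pi_j(1-x)\frac{Q_j(x)}{q_0},\qquad j\ge0,$$ is a quasi-stationary distribution. Different values of $x\in[\eta,1)$ give different sequences $\alpha(x)$, and the quasi-stationary distributions are exactly the $\alpha(x)$ with $\eta\le x<1$. -/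

import Mathlib

open Filter Topology MeasureTheory

noncomputable section

namespace KarlinMcGregor

/-- The one-step transition matrix `ℙ` on the states `0, 1, 2, …`: the first row is
`(r₀, p₀, 0, …)`, every other row has `q` below, `0` on and `p` above the diagonal. -/
def transition (r₀ p₀ p q : ℝ) : ℕ → ℕ → ℝ
  | 0, j => if j = 0 then r₀ else if j = 1 then p₀ else 0
  | i + 1, j => if j = i then q else if j = i + 2 then p else 0

/-- The transition matrix of the walk together with its absorbing state. The state `some i` is the
state `i`, and `none` is the absorbing state `-1`, entered from `0` with probability
`q₀ = 1 - r₀ - p₀`. -/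
def fullTransition (r₀ p₀ p q : ℝ) : Option ℕ → Option ℕ → ℝ
  | none, none => 1
  | none, some _ => 0
  | some 0, none => 1 - r₀ - p₀
  | some (_ + 1), none => 0
  | some i, some j => transition r₀ p₀ p q i j

/-- The law at time `n` of the walk started from the distribution `α` on `0, 1, 2, …`:
`law … α n (some j)` is the probability of being at `j` at time `n`, and `law … α n none` is the
probability of having been absorbed by time `n`. All series here have at most three nonzero
terms. -/
def law (r₀ p₀ p q : ℝ) (α : ℕ → ℝ) : ℕ → Option ℕ → ℝ
  | 0, none => 0
  | 0, some j => α j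
  | n + 1, y => ∑' x : Option ℕ, law r₀ p₀ p q α n x * fullTransition r₀ p₀ p q x y

/-- Probability distributions on the nonnegative integers. -/
def IsDistribution (α : ℕ → ℝ) : Prop :=
  (∀ j, 0 ≤ α j) ∧ HasSum α 1

/-- Quasi-stationary distributions: conditionally on no absorption by time `n`, the walk started
from `α` is at `j` at time `n` with probability `α j`. -/
def IsQuasiStationary (r₀ p₀ p q : ℝ) (α : ℕ → ℝ) : Prop :=
  IsDistribution α ∧
    ∀ n : ℕ, law r₀ p₀ p q α n none < 1 ∧
      ∀ j : ℕ, law r₀ p₀ p q α n (some j) / (1 - law r₀ p₀ p q α n none) = α j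

/-- `π₀ = 1` and `π_j = p₀ p^(j-1) / q^j` for `j ≥ 1`. -/
def weight (p₀ p q : ℝ) : ℕ → ℝ
  | 0 => 1
  | j + 1 => p₀ * p ^ j / q ^ (j + 1)

/-- The eigenfunctions `Q_j`, through Chebyshev polynomials of the first and second kind in the
variable `x / (2 √(p q))`; note that `U_{-1} = 0`. -/
def eigenfun (r₀ p₀ p q : ℝ) (j : ℕ) (x : ℝ) : ℝ :=
  √(q / p) ^ j *
    (2 * (p₀ - p) / p₀ * (Polynomial.Chebyshev.T ℝ j).eval (x / (2 * √(p * q)))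
      + (2 * p - p₀) / p₀ * (Polynomial.Chebyshev.U ℝ j).eval (x / (2 * √(p * q)))
      - r₀ / p₀ * √(p / q)
          * (Polynomial.Chebyshev.U ℝ ((j : ℤ) - 1)).eval (x / (2 * √(p * q))))

/-- `ψ` is a measure supported in `[-1, 1]` with `π_j ∫ Q_i Q_j dψ = δ_ij`. The case `i = j = 0`
makes `ψ` a probability measure, so all these integrals converge. -/
def IsOrthogonalityMeasure (r₀ p₀ p q : ℝ) (ψ : Measure ℝ) : Prop :=
  ψ (Set.Icc (-1) 1)ᶜ = 0 ∧
    ∀ i j : ℕ, weight p₀ p q j * ∫ x, eigenfun r₀ p₀ p q i x * eigenfun r₀ p₀ p q j x ∂ψ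
      = if i = j then 1 else 0

/-- `α_j(x) = π_j (1 - x) Q_j(x) / q₀` with `q₀ = 1 - r₀ - p₀`. -/
def family (r₀ p₀ p q : ℝ) (x : ℝ) (j : ℕ) : ℝ :=
  weight p₀ p q j * (1 - x) * eigenfun r₀ p₀ p q j x / (1 - r₀ - p₀)

end KarlinMcGregor

end

open KarlinMcGregor

namespace KarlinMcGregor

/-! The solutions of ℙv = xv form a line spanned by Q(x), and detailed balance (`weight_succ_mul`)
turns a left eigenvector into `weight` times a right one. A quasi-stationary α survives one step
with probability x = 1 - q₀α₀ and is a left eigenvector for this x, so α is `family` at x and no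
Q_n(x) is negative. Conversely, if x < 1 and all Q_n(x) are positive, `family` at x is a nonnegative
left eigenvector, and a flux argument using p ≤ q shows that its total mass is 1
(`hasSum_one_of_step_eq`). Everything reduces to finding the x < 1 at which all Q_n are positive.

These are the x ≥ η. The measure ψ is the spectral measure of a bounded self-adjoint Jacobi
operator, the symmetrisation of ℙ. If Q(x) > 0, then Q(x) is a positive solution, completing squares
makes the form of x - J nonnegative (`functional_form_lower_bound`), and ψ has no mass to the right
of x. If ψ has no mass to the right of x, then orthogonality to lower degrees forbids Q_n(x) = 0
(`eval_qPoly_ne_zero_of_ae_le`); for x ≤ 1 the sign is then that of Q_n(1) > 0. This includes x = η.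

For p = 1/2 and x < 1, concavity in n drives Q_n(x) below zero, so η = 1; for p < 1/2 some x < 1
makes Q_n(x) grow geometrically, so η < 1. Absorption is certain because the limiting survival
probability is a bounded solution of ℙu = u, hence a multiple of the unbounded sequence Q(1). -/

/-! ### Spectral measures of bounded self-adjoint operators -/

open Polynomial CompactlySupported in
-- The continuous functional calculus makes h ↦ ⟨v, h(J)v⟩ a positive functional on the continuous
-- functions of the compact spectrum; Riesz–Markov represents it by a measure, which is pushed
-- forward to ℝ.
theorem exists_spectral_measure {H : Type*} [NormedAddCommGroup H] [InnerProductSpace ℂ H]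
    [CompleteSpace H] (J : H →L[ℂ] H) (hJ : IsSelfAdjoint J) (v : H) :
    ∃ ψ : Measure ℝ, IsFiniteMeasure ψ ∧ (∃ M : ℝ, ψ (Set.Icc (-M) M)ᶜ = 0) ∧
      ∀ P : ℝ[X], ∫ x, P.eval x ∂ψ = (inner ℂ v (aeval J P v)).re := by
  let φ := cfcHom (R := ℝ) hJ
  have hφ : ∀ P : ℝ[X], φ (P.toContinuousMapOn _) = aeval J P := by
    intro P
    have h1 : P.toContinuousMapOn (spectrum ℝ J) =
        aeval ((ContinuousMap.id ℝ).restrict (spectrum ℝ J)) P := by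
      ext x
      simp [Polynomial.aeval_continuousMap_apply]
    rw [h1]
    have := (Polynomial.aeval_algHom_apply (φ : C(spectrum ℝ J, ℝ) →ₐ[ℝ] (H →L[ℂ] H))
      ((ContinuousMap.id ℝ).restrict (spectrum ℝ J)) P)
    simp only [StarAlgHom.coe_toAlgHom] at this
    rw [← this, cfcHom_id hJ]
  let L : C_c(spectrum ℝ J, ℝ) →ₗ[ℝ] ℝ :=
    { toFun := fun f => (inner ℂ v (φ f.toContinuousMap v)).re
      map_add' := fun f g => by
        have : (f + g).toContinuousMap = f.toContinuousMap + g.toContinuousMap := rfl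
        rw [this, map_add]
        simp
      map_smul' := fun c f => by
        have : (c • f).toContinuousMap = c • f.toContinuousMap := rfl
        rw [this, map_smul]
        simp }
  have hL : ∀ f : C_c(spectrum ℝ J, ℝ), 0 ≤ f → 0 ≤ L f := by
    intro f hf
    -- With g = √f, the value ⟨v, f(J)v⟩ is the squared norm of g(J)v.
    let g : C(spectrum ℝ J, ℝ) := ⟨fun x => √(f x), by fun_prop⟩
    have hg : f.toContinuousMap = star g * g := by
      ext x
      exact (Real.mul_self_sqrt (hf x)).symm
    change 0 ≤ (inner ℂ v (φ f.toContinuousMap v)).re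
    rw [hg, map_mul, map_star]
    simp only [mul_apply_eq_comp, ContinuousLinearMap.star_eq_adjoint,
      ContinuousLinearMap.adjoint_inner_right]
    exact inner_self_nonneg (𝕜 := ℂ)
  let Λ : C_c(spectrum ℝ J, ℝ) →ₚ[ℝ] ℝ := PositiveLinearMap.mk₀ L hL
  let μ := RealRMK.rieszMeasure Λ
  have hK : IsCompact (spectrum ℝ J) := isCompact_iff_compactSpace.mpr inferInstance
  refine ⟨μ.map Subtype.val, inferInstance, ?_, ?_⟩
  · obtain ⟨M, hM⟩ := hK.isBounded.subset_closedBall 0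
    refine ⟨M, ?_⟩
    rw [Measure.map_apply measurable_subtype_coe measurableSet_Icc.compl]
    convert measure_empty (μ := μ)
    ext x
    have := hM x.2
    rw [Real.closedBall_eq_Icc] at this
    simpa using this
  · intro P
    rw [integral_map measurable_subtype_coe.aemeasurable P.continuous.aestronglyMeasurable]
    have := RealRMK.integral_rieszMeasure Λ
      (CompactlySupportedContinuousMap.continuousMapEquiv (P.toContinuousMapOn (spectrum ℝ J)))
    rw [← hφ]
    exact this

/-! ### The polynomials Q_n and the Jacobi operator -/

/-- The probability of a step up from state `n`. -/
noncomputable def up (p₀ p : ℝ) : ℕ → ℝ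
  | 0 => p₀
  | _ + 1 => p

open Polynomial in
/-- The polynomials of which the functions `Q_j` are the evaluations. -/
noncomputable def qPoly (r₀ p₀ p q : ℝ) : ℕ → ℝ[X]
  | 0 => 1
  | 1 => C p₀⁻¹ * (X - C r₀)
  | n + 2 => C p⁻¹ * (X * qPoly r₀ p₀ p q (n + 1) - C q * qPoly r₀ p₀ p q n)

section weight
variable {p₀ p q : ℝ} (hp₀ : 0 < p₀) (hp : 0 < p) (hq : 0 < q)
include hp₀ hp

theorem up_pos (n : ℕ) : 0 < up p₀ p n := by
  cases n <;> simpa [up]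

include hq

theorem weight_pos (n : ℕ) : 0 < weight p₀ p q n := by
  cases n <;> simp only [weight] <;> positivity

omit hp₀ hp in
-- Detailed balance: this identity makes ℙ symmetric with respect to `weight`.
theorem weight_succ_mul (n : ℕ) : weight p₀ p q (n + 1) * q = weight p₀ p q n * up p₀ p n := by
  rcases n with _ | n
  · simp only [weight, up]
    field_simp
    ring
  · simp only [weight, up]
    field_simp
    ring

end weight

/-- Conjugating ℙ by √`weight` gives a symmetric tridiagonal matrix, a finite-rank perturbation of
√(pq) times shift plus adjoint. The f n are the basis vectors divided by √(`weight` n), on which J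
acts by the recurrence that multiplication by X obeys on the Q_n. -/
theorem exists_jacobi_operator (r₀ : ℝ) {p₀ p q : ℝ} (hp₀ : 0 < p₀) (hp : 0 < p) (hq : 0 < q) :
    ∃ (J : lp (fun _ : ℕ => ℂ) 2 →L[ℂ] lp (fun _ : ℕ => ℂ) 2) (f : ℕ → lp (fun _ : ℕ => ℂ) 2),
      IsSelfAdjoint J ∧
      (∀ i j, inner ℂ (f i) (f j) = if i = j then (((weight p₀ p q j)⁻¹ : ℝ) : ℂ) else 0) ∧
      J (f 0) = (r₀ : ℂ) • f 0 + (p₀ : ℂ) • f 1 ∧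
      ∀ n, J (f (n + 1)) = (q : ℂ) • f n + (p : ℂ) • f (n + 2) := by
  let b : HilbertBasis ℕ ℂ (lp (fun _ : ℕ => ℂ) 2) :=
    HilbertBasis.ofRepr (LinearIsometryEquiv.refl ℂ _)
  have hb : Orthonormal ℂ b := b.orthonormal
  have hb' := orthonormal_iff_ite.mp hb
  have hs : Orthonormal ℂ (fun n => b (n + 1)) := hb.comp _ (add_left_injective 1)
  let S : lp (fun _ : ℕ => ℂ) 2 →L[ℂ] lp (fun _ : ℕ => ℂ) 2 :=
    (hs.orthogonalFamily.linearIsometry).toContinuousLinearMap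
  have hS : ∀ n, S (b n) = b (n + 1) := by
    intro n
    have h1 : b n = lp.single 2 n (1 : ℂ) := by
      rw [← b.repr_symm_single]; rfl
    change hs.orthogonalFamily.linearIsometry (b n) = _
    rw [h1, OrthogonalFamily.linearIsometry_apply_single]
    simp
  have hadj : ∀ x y, inner ℂ x (S.adjoint y) = inner ℂ (S x) y :=
    fun x y => ContinuousLinearMap.adjoint_inner_right S x y
  have hS0 : S.adjoint (b 0) = 0 := by
    apply b.repr.injective
    ext i
    rw [b.repr_apply_apply, hadj, hS, hb']
    simp
  have hS1 : ∀ n, S.adjoint (b (n + 1)) = b n := by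
    intro n
    apply b.repr.injective
    ext i
    rw [b.repr_apply_apply, b.repr_apply_apply, hadj, hS, hb', hb']
    simp
  -- The symmetrised entry between 0 and 1 is √(p₀q), while the shift part supplies √(pq); c is the
  -- difference.
  let c : ℝ := √(p₀ * q) - √(p * q)
  let R : ℕ → ℕ → lp (fun _ : ℕ => ℂ) 2 →L[ℂ] lp (fun _ : ℕ => ℂ) 2 :=
    fun i j => (innerSL ℂ (b i)).smulRight (b j)
  let J : lp (fun _ : ℕ => ℂ) 2 →L[ℂ] lp (fun _ : ℕ => ℂ) 2 :=
    ((√(p * q) : ℝ) : ℂ) • (S + S.adjoint) + (r₀ : ℂ) • R 0 0 + (c : ℂ) • (R 0 1 + R 1 0)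
  have hJ : ∀ x, J x = ((√(p * q) : ℝ) : ℂ) • (S x + S.adjoint x) +
      (r₀ : ℂ) • ((inner ℂ (b 0) x : ℂ) • b 0) +
      (c : ℂ) • ((inner ℂ (b 0) x : ℂ) • b 1 + (inner ℂ (b 1) x : ℂ) • b 0) := fun x => rfl
  have hw := weight_pos hp₀ hp hq
  have hws := weight_succ_mul (p₀ := p₀) (p := p) hq
  have hJ0 : J (b 0) = (r₀ : ℂ) • b 0 + ((√(p₀ * q) : ℝ) : ℂ) • b 1 := by
    rw [hJ, hS, hS0, hb', hb']
    simp only [c, Complex.ofReal_sub]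
    simp
    module
  have hJ1 : J (b 1) = ((√(p₀ * q) : ℝ) : ℂ) • b 0 + ((√(p * q) : ℝ) : ℂ) • b 2 := by
    rw [hJ, hS, hS1, hb', hb']
    simp only [c, Complex.ofReal_sub]
    simp
    module
  have hJ2 : ∀ n, J (b (n + 2)) =
      ((√(p * q) : ℝ) : ℂ) • b (n + 1) + ((√(p * q) : ℝ) : ℂ) • b (n + 3) := by
    intro n
    rw [hJ, hS, hS1, hb', hb']
    simp
    module
  have hJs : ∀ n, J (b (n + 1)) =
      ((√(up p₀ p n * q) : ℝ) : ℂ) • b n + ((√(p * q) : ℝ) : ℂ) • b (n + 2) := by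
    rintro (_ | n)
    · simpa [up] using hJ1
    · simpa [up] using hJ2 n
  have key : ∀ n, √(up p₀ p n * q) * (√(weight p₀ p q n))⁻¹ =
      up p₀ p n * (√(weight p₀ p q (n + 1)))⁻¹ := by
    intro n
    have hu := up_pos hp₀ hp n
    have h1 : up p₀ p n = weight p₀ p q (n + 1) * q / weight p₀ p q n := by
      rw [hws]; field_simp [(hw n).ne']
    have hw0 := hw n
    have hw1 := hw (n + 1)
    rw [← div_eq_mul_inv, ← div_eq_mul_inv, ← Real.sqrt_div (by positivity),
      ← Real.sqrt_sq (by positivity : 0 ≤ up p₀ p n / √(weight p₀ p q (n + 1)))]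
    congr 1
    rw [div_pow, Real.sq_sqrt hw1.le]
    rw [div_eq_div_iff hw0.ne' hw1.ne']
    linear_combination up p₀ p n * hws n
  have key' : ∀ n, √(up p₀ p n * q) * (√(weight p₀ p q (n + 1)))⁻¹ =
      q * (√(weight p₀ p q n))⁻¹ := by
    intro n
    have hu := up_pos hp₀ hp n
    have hw0 := hw n
    have hw1 := hw (n + 1)
    rw [← div_eq_mul_inv, ← div_eq_mul_inv, ← Real.sqrt_div (by positivity),
      ← Real.sqrt_sq (by positivity : 0 ≤ q / √(weight p₀ p q n))]
    congr 1
    rw [div_pow, Real.sq_sqrt hw0.le]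
    rw [div_eq_div_iff hw1.ne' hw0.ne']
    linear_combination -q * hws n
  refine ⟨J, fun n => (((√(weight p₀ p q n))⁻¹ : ℝ) : ℂ) • b n, ?_, ?_, ?_, ?_⟩
  · rw [ContinuousLinearMap.isSelfAdjoint_iff_isSymmetric]
    intro x y
    have h1 : inner ℂ (S.adjoint x) y = inner ℂ x (S y) :=
      ContinuousLinearMap.adjoint_inner_left S y x
    change inner ℂ (J x) y = inner ℂ x (J y)
    simp only [hJ, inner_add_left, inner_add_right, inner_smul_left, inner_smul_right, h1, hadj,
      Complex.conj_ofReal, inner_conj_symm]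
    ring
  · intro i j
    rw [inner_smul_left, inner_smul_right, hb', Complex.conj_ofReal]
    split_ifs with h
    · subst h
      rw [mul_one, ← Complex.ofReal_mul, ← mul_inv, Real.mul_self_sqrt (hw i).le]
    · simp
  · have := key 0
    simp only [up] at this
    rw [map_smul, hJ0, smul_add, smul_smul, smul_smul, smul_smul, smul_smul, ← Complex.ofReal_mul,
      ← Complex.ofReal_mul, ← Complex.ofReal_mul, ← Complex.ofReal_mul, ← this]
    congr 3 <;> rw [mul_comm]
  · intro n
    have h1 := key' n
    have h2 := key (n + 1)
    simp only [up] at h2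
    rw [map_smul, hJs, smul_add, smul_smul, smul_smul, smul_smul, smul_smul, ← Complex.ofReal_mul,
      ← Complex.ofReal_mul, ← Complex.ofReal_mul, ← Complex.ofReal_mul, ← h1, ← h2]
    congr 3 <;> rw [mul_comm]

open Polynomial in
-- The recurrence forces Q_n(J) f₀ = f_n, and Q_i(J) is self-adjoint, so ∫ Q_i Q_j dψ = ⟨f_i, f_j⟩
-- for the spectral measure ψ of f₀.
theorem exists_qPoly_measure_of_operator {H : Type*} [NormedAddCommGroup H]
    [InnerProductSpace ℂ H] [CompleteSpace H] (r₀ : ℝ) {p₀ p q : ℝ} (hp₀ : 0 < p₀) (hp : 0 < p)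
    (J : H →L[ℂ] H) (hJ : IsSelfAdjoint J) (f : ℕ → H)
    (hf : ∀ i j, inner ℂ (f i) (f j) = if i = j then (((weight p₀ p q j)⁻¹ : ℝ) : ℂ) else 0)
    (h0 : J (f 0) = (r₀ : ℂ) • f 0 + (p₀ : ℂ) • f 1)
    (h1 : ∀ n, J (f (n + 1)) = (q : ℂ) • f n + (p : ℂ) • f (n + 2)) :
    ∃ ψ : Measure ℝ, IsFiniteMeasure ψ ∧ (∃ M : ℝ, ψ (Set.Icc (-M) M)ᶜ = 0) ∧
      ∀ i j, ∫ x, (qPoly r₀ p₀ p q i).eval x * (qPoly r₀ p₀ p q j).eval x ∂ψ =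
        if i = j then (weight p₀ p q j)⁻¹ else 0 := by
  obtain ⟨ψ, hψ, hM, hint⟩ := exists_spectral_measure J hJ (f 0)
  have hC : ∀ (a : ℝ) v, aeval J (C a : ℝ[X]) v = (a : ℂ) • v := by
    intro a v
    rw [aeval_C]
    rfl
  have hq' : ∀ n, aeval J (qPoly r₀ p₀ p q n) (f 0) = f n ∧
      aeval J (qPoly r₀ p₀ p q (n + 1)) (f 0) = f (n + 1) := by
    intro n
    induction n with
    | zero =>
      refine ⟨by simp [qPoly], ?_⟩
      simp only [qPoly, map_mul, map_sub, aeval_X, mul_apply_eq_comp,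
        sub_apply, hC, h0, zero_add]
      rw [add_sub_cancel_left, smul_smul, ← Complex.ofReal_mul, inv_mul_cancel₀ hp₀.ne']
      simp
    | succ n ih =>
      refine ⟨ih.2, ?_⟩
      simp only [qPoly, map_mul, map_sub, aeval_X, mul_apply_eq_comp,
        sub_apply, hC, h1, ih.1, ih.2]
      rw [add_sub_cancel_left, smul_smul, ← Complex.ofReal_mul, inv_mul_cancel₀ hp.ne']
      simp
  have hsa : ∀ P : ℝ[X], IsSelfAdjoint (aeval J P) := by
    intro P
    rw [← cfc_polynomial P J hJ]
    exact cfc_predicate _ _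
  refine ⟨ψ, hψ, hM, fun i j => ?_⟩
  simp only [← eval_mul]
  rw [hint, map_mul, mul_apply_eq_comp]
  rw [(hq' j).1]
  have h2 := ContinuousLinearMap.adjoint_inner_left (aeval J (qPoly r₀ p₀ p q i)) (f j) (f 0)
  rw [← h2, (ContinuousLinearMap.isSelfAdjoint_iff').mp (hsa _), (hq' i).1, hf]
  split_ifs <;> simp

theorem exists_qPoly_measure (r₀ : ℝ) {p₀ p q : ℝ} (hp₀ : 0 < p₀) (hp : 0 < p) (hq : 0 < q) :
    ∃ ψ : Measure ℝ, IsFiniteMeasure ψ ∧ (∃ M : ℝ, ψ (Set.Icc (-M) M)ᶜ = 0) ∧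
      ∀ i j, ∫ x, (qPoly r₀ p₀ p q i).eval x * (qPoly r₀ p₀ p q j).eval x ∂ψ =
        if i = j then (weight p₀ p q j)⁻¹ else 0 := by
  obtain ⟨J, f, hJ, hf, h0, h1⟩ := exists_jacobi_operator r₀ hp₀ hp hq
  exact exists_qPoly_measure_of_operator r₀ hp₀ hp J hJ f hf h0 h1

/-! ### Recurrence and degrees of the Q_n -/

section eval
variable (r₀ p₀ p q x : ℝ)

theorem eval_qPoly_zero : (qPoly r₀ p₀ p q 0).eval x = 1 := by simp [qPoly]

variable {p₀ p}

theorem mul_eval_qPoly_one (hp₀ : 0 < p₀) :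
    p₀ * (qPoly r₀ p₀ p q 1).eval x = x - r₀ := by
  simp [qPoly]
  field_simp

theorem mul_eval_qPoly_add_two (hp : 0 < p) (n : ℕ) :
    p * (qPoly r₀ p₀ p q (n + 2)).eval x =
      x * (qPoly r₀ p₀ p q (n + 1)).eval x - q * (qPoly r₀ p₀ p q n).eval x := by
  simp [qPoly]
  field_simp

open Polynomial in
theorem X_mul_qPoly_zero (hp₀ : 0 < p₀) :
    X * qPoly r₀ p₀ p q 0 = r₀ • qPoly r₀ p₀ p q 0 + p₀ • qPoly r₀ p₀ p q 1 := by
  refine Polynomial.funext fun x => ?_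
  have h1 := mul_eval_qPoly_one r₀ (p := p) q x hp₀
  have h0 := eval_qPoly_zero r₀ p₀ p q x
  simp only [eval_mul, eval_add, eval_smul, eval_X, smul_eq_mul, h1, h0]
  ring

open Polynomial in
theorem X_mul_qPoly_succ (hp : 0 < p) (n : ℕ) :
    X * qPoly r₀ p₀ p q (n + 1) = q • qPoly r₀ p₀ p q n + p • qPoly r₀ p₀ p q (n + 2) := by
  refine Polynomial.funext fun x => ?_
  have h1 := mul_eval_qPoly_add_two r₀ (p₀ := p₀) q x hp n
  simp only [eval_mul, eval_add, eval_smul, eval_X, smul_eq_mul, h1]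
  ring

end eval

theorem coeff_qPoly (r₀ : ℝ) {p₀ p : ℝ} (q : ℝ) (hp₀ : 0 < p₀) (hp : 0 < p) (n : ℕ) :
    (∀ m, n < m → (qPoly r₀ p₀ p q n).coeff m = 0) ∧ 0 < (qPoly r₀ p₀ p q n).coeff n := by
  induction n using Nat.twoStepInduction with
  | zero =>
    refine ⟨fun m hm => ?_, by simp [qPoly]⟩
    simp [qPoly, Polynomial.coeff_one, hm.ne']
  | one =>
    refine ⟨fun m hm => ?_, ?_⟩
    · simp only [qPoly, Polynomial.coeff_C_mul, Polynomial.coeff_sub, Polynomial.coeff_X,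
        Polynomial.coeff_C]
      rw [if_neg (by omega), if_neg (by omega)]
      simp
    · simpa [qPoly, Polynomial.coeff_X, Polynomial.coeff_C] using hp₀
  | more n ih0 ih1 =>
    refine ⟨fun m hm => ?_, ?_⟩
    · obtain ⟨m, rfl⟩ : ∃ k, m = k + 1 := ⟨m - 1, by omega⟩
      simp only [qPoly, Polynomial.coeff_C_mul, Polynomial.coeff_sub, Polynomial.coeff_X_mul]
      rw [ih1.1 m (by omega), ih0.1 (m + 1) (by omega)]
      simp
    · simp only [qPoly, Polynomial.coeff_C_mul, Polynomial.coeff_sub, Polynomial.coeff_X_mul]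
      rw [ih0.1 (n + 1 + 1) (by omega)]
      have := ih1.2
      simp only [mul_zero, sub_zero]
      positivity

open Polynomial in
theorem exists_eq_sum_qPoly (r₀ : ℝ) {p₀ p : ℝ} (q : ℝ) (hp₀ : 0 < p₀) (hp : 0 < p) (n : ℕ)
    (g : ℝ[X]) (hg : ∀ m, n ≤ m → g.coeff m = 0) :
    ∃ c : ℕ → ℝ, g = ∑ i ∈ Finset.range n, c i • qPoly r₀ p₀ p q i := by
  induction n generalizing g with
  | zero =>
    refine ⟨0, ?_⟩
    ext m
    simp [hg m]
  | succ n ih =>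
    have hQ := coeff_qPoly r₀ q hp₀ hp n
    set a := g.coeff n / (qPoly r₀ p₀ p q n).coeff n with ha
    obtain ⟨c, hc⟩ := ih (g - a • qPoly r₀ p₀ p q n) (by
      intro m hm
      rw [coeff_sub, coeff_smul, smul_eq_mul]
      rcases hm.eq_or_lt with rfl | hm
      · rw [ha, div_mul_cancel₀ _ hQ.2.ne', sub_self]
      · rw [hg m hm, hQ.1 m hm, mul_zero, sub_zero])
    refine ⟨Function.update c n a, ?_⟩
    rw [Finset.sum_range_succ, Function.update_self, ← sub_eq_iff_eq_add, hc]
    refine Finset.sum_congr rfl fun i hi => ?_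
    rw [Function.update_of_ne (Finset.mem_range.mp hi).ne]

/-! ### Orthogonality functionals and positivity of quadratic forms -/

section functional
open Polynomial
variable {r₀ p₀ p q : ℝ} {L : ℝ[X] →ₗ[ℝ] ℝ}
  (hL : ∀ i j, L (qPoly r₀ p₀ p q i * qPoly r₀ p₀ p q j) =
    if i = j then (weight p₀ p q j)⁻¹ else 0)
include hL

theorem functional_qPoly_mul_eq_zero (hp₀ : 0 < p₀) (hp : 0 < p) (n : ℕ) (g : ℝ[X])
    (hg : ∀ m, n ≤ m → g.coeff m = 0) : L (qPoly r₀ p₀ p q n * g) = 0 := by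
  obtain ⟨c, rfl⟩ := exists_eq_sum_qPoly r₀ q hp₀ hp n g hg
  rw [Finset.mul_sum, map_sum]
  refine Finset.sum_eq_zero fun i hi => ?_
  rw [mul_smul_comm, map_smul, hL, if_neg (Finset.mem_range.mp hi).ne', smul_zero]

theorem functional_X_mul_qPoly (hp₀ : 0 < p₀) (hp : 0 < p) (n i : ℕ) (hi : i ≤ n) :
    L (X * qPoly r₀ p₀ p q i * qPoly r₀ p₀ p q (n + 1)) =
      if i = n then up p₀ p n * (weight p₀ p q (n + 1))⁻¹ else 0 := by
  cases i with
  | zero =>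
    rw [X_mul_qPoly_zero r₀ q hp₀, add_mul, smul_mul_assoc, smul_mul_assoc, map_add, map_smul,
      map_smul, hL, hL]
    cases n <;> simp [up]
  | succ k =>
    rw [X_mul_qPoly_succ r₀ q hp, add_mul, smul_mul_assoc, smul_mul_assoc, map_add, map_smul,
      map_smul, hL, hL, if_neg (by omega)]
    by_cases h : k + 1 = n
    · subst h
      simp [up]
    · rw [if_neg (by omega), if_neg h]
      simp

theorem functional_X_mul_qPoly_self (hp : 0 < p) (n : ℕ) :
    L (X * qPoly r₀ p₀ p q (n + 1) * qPoly r₀ p₀ p q (n + 1)) = 0 := by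
  rw [X_mul_qPoly_succ r₀ q hp, add_mul, smul_mul_assoc, smul_mul_assoc, map_add, map_smul,
      map_smul, hL, hL, if_neg (by omega), if_neg (by omega)]
  simp

/-- In the basis Q_i the form of x - sX is tridiagonal, and a positive supersolution v of ℙv ≤ xv
lets it be reduced to squares one index at a time. The left side is the part of the last diagonal
entry left over to absorb the next cross term. Both signs s work, since s enters only through those
cross terms and r₀ ≥ 0. -/
theorem functional_form_lower_bound (hr₀ : 0 ≤ r₀) (hp₀ : 0 < p₀) (hp : 0 < p) (hq : 0 < q)
    {x s : ℝ} (hs : s = 1 ∨ s = -1) {v : ℕ → ℝ} (hv : ∀ n, 0 < v n)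
    (h0 : r₀ * v 0 + p₀ * v 1 ≤ x * v 0)
    (h1 : ∀ n, q * v n + p * v (n + 2) ≤ x * v (n + 1)) (c : ℕ → ℝ) (n : ℕ) :
    up p₀ p n * (v (n + 1) / v n) * c n ^ 2 / weight p₀ p q n ≤
      L ((x • 1 - s • X) * (∑ i ∈ Finset.range (n + 1), c i • qPoly r₀ p₀ p q i) ^ 2) := by
  induction n with
  | zero =>
    have e : (x • 1 - s • X) * (∑ i ∈ Finset.range (0 + 1), c i • qPoly r₀ p₀ p q i) ^ 2 =
        (x * c 0 ^ 2) • (qPoly r₀ p₀ p q 0 * qPoly r₀ p₀ p q 0) -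
          (s * c 0 ^ 2) • (X * qPoly r₀ p₀ p q 0 * qPoly r₀ p₀ p q 0) := by
      simp only [zero_add, Finset.sum_range_one, smul_eq_C_mul, C_mul, C_pow]
      ring
    have e2 : L (X * qPoly r₀ p₀ p q 0 * qPoly r₀ p₀ p q 0) = r₀ := by
      rw [X_mul_qPoly_zero r₀ q hp₀, add_mul, smul_mul_assoc, smul_mul_assoc, map_add, map_smul,
        map_smul, hL, hL]
      simp [weight]
    rw [e, map_sub, map_smul, map_smul, e2, hL]
    have h2 : p₀ * (v 1 / v 0) ≤ x - r₀ := by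
      rw [← mul_div_assoc, div_le_iff₀ (hv 0)]
      linarith
    have h3 : x - r₀ ≤ x - s * r₀ := by
      rcases hs with rfl | rfl <;> linarith
    simp only [up, weight, if_true, smul_eq_mul]
    have := mul_le_mul_of_nonneg_right (h2.trans h3) (sq_nonneg (c 0))
    linarith
  | succ n ih =>
    set g := ∑ i ∈ Finset.range (n + 1), c i • qPoly r₀ p₀ p q i with hg
    set Q := qPoly r₀ p₀ p q (n + 1) with hQ
    have e : (x • 1 - s • X) * (g + c (n + 1) • Q) ^ 2 =
        (x • 1 - s • X) * g ^ 2 + (2 * c (n + 1) * x) • (g * Q)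
          - (2 * c (n + 1) * s) • (X * g * Q) + (c (n + 1) ^ 2 * x) • (Q * Q)
          - (c (n + 1) ^ 2 * s) • (X * Q * Q) := by
      simp only [smul_eq_C_mul, C_mul, C_pow, C_ofNat]
      ring
    have e1 : L (g * Q) = 0 := by
      rw [hg, Finset.sum_mul, map_sum]
      refine Finset.sum_eq_zero fun i hi => ?_
      rw [smul_mul_assoc, map_smul, hL, if_neg (Finset.mem_range.mp hi).ne, smul_zero]
    have e2 : L (X * g * Q) = c n * (up p₀ p n * (weight p₀ p q (n + 1))⁻¹) := by
      rw [hg, Finset.mul_sum, Finset.sum_mul, map_sum, Finset.sum_eq_single n]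
      · rw [mul_smul_comm, smul_mul_assoc, map_smul, functional_X_mul_qPoly hL hp₀ hp n n le_rfl,
          if_pos rfl, smul_eq_mul]
      · intro i hi hin
        have := Finset.mem_range.mp hi
        rw [mul_smul_comm, smul_mul_assoc, map_smul,
          functional_X_mul_qPoly hL hp₀ hp n i (by omega), if_neg hin, smul_zero]
      · simp
    rw [Finset.sum_range_succ, ← hg, e, map_sub, map_add, map_sub, map_add, map_smul, map_smul,
      map_smul, map_smul, e1, e2, hL, functional_X_mul_qPoly_self hL hp, if_pos rfl]
    simp only [smul_eq_mul, mul_zero, add_zero, sub_zero]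
    have hw := weight_pos hp₀ hp hq n
    have hw' := weight_pos hp₀ hp hq (n + 1)
    have hws := weight_succ_mul (p₀ := p₀) (p := p) hq n
    have hu := up_pos hp₀ hp n
    have hρ : 0 < v (n + 1) / v n := div_pos (hv _) (hv _)
    -- The supersolution inequality splits the diagonal entry x: the part q/ρ completes the present
    -- square and the part pρ' is saved for the next index.
    have hx : q / (v (n + 1) / v n) + p * (v (n + 2) / v (n + 1)) ≤ x := by
      rw [div_div_eq_mul_div, ← mul_div_assoc, ← add_div, div_le_iff₀ (hv _)]
      exact h1 n
    have hs2 : s ^ 2 = 1 := by rcases hs with rfl | rfl <;> norm_num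
    rw [show up p₀ p (n + 1) = p from rfl]
    set ρ := v (n + 1) / v n
    set ρ' := v (n + 2) / v (n + 1)
    set w := weight p₀ p q n
    set w' := weight p₀ p q (n + 1)
    set u := up p₀ p n
    set a := c n
    set b := c (n + 1)
    have hwe : u / w = u ^ 2 / (w' * q) := by
      rw [div_eq_div_iff hw.ne' (by positivity)]
      linear_combination u * hws
    have key : u * ρ * a ^ 2 / w - 2 * b * s * (a * (u * w'⁻¹)) + b ^ 2 * (q / ρ) * w'⁻¹ =
        (u * a * ρ - s * b * q) ^ 2 / (w' * q * ρ) := by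
      have : u * ρ * a ^ 2 / w = (u / w) * ρ * a ^ 2 := by ring
      rw [this, hwe]
      field_simp
      linear_combination (-b ^ 2 * q ^ 2) * hs2
    have hpos : 0 ≤ (u * a * ρ - s * b * q) ^ 2 / (w' * q * ρ) := by positivity
    have h3 := mul_le_mul_of_nonneg_left hx (by positivity : 0 ≤ b ^ 2 * w'⁻¹)
    have h4 : p * ρ' * b ^ 2 / w' = b ^ 2 * w'⁻¹ * (p * ρ') := by ring
    rw [h4]
    linarith

theorem functional_form_nonneg (hr₀ : 0 ≤ r₀) (hp₀ : 0 < p₀) (hp : 0 < p) (hq : 0 < q)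
    {x s : ℝ} (hs : s = 1 ∨ s = -1) {v : ℕ → ℝ} (hv : ∀ n, 0 < v n)
    (h0 : r₀ * v 0 + p₀ * v 1 ≤ x * v 0)
    (h1 : ∀ n, q * v n + p * v (n + 2) ≤ x * v (n + 1)) (g : ℝ[X]) :
    0 ≤ L ((x • 1 - s • X) * g ^ 2) := by
  obtain ⟨c, hc⟩ := exists_eq_sum_qPoly r₀ q hp₀ hp (g.natDegree + 1) g
    (fun m hm => coeff_eq_zero_of_natDegree_lt hm)
  have := functional_form_lower_bound hL hr₀ hp₀ hp hq hs hv h0 h1 c g.natDegree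
  rw [← hc] at this
  refine le_trans ?_ this
  have hw := weight_pos hp₀ hp hq g.natDegree
  have hu := up_pos hp₀ hp g.natDegree
  have := div_pos (hv (g.natDegree + 1)) (hv g.natDegree)
  positivity

end functional

/-! ### Compactly supported measures tested against polynomials -/

section measure
open Polynomial

theorem integrable_of_continuous {ψ : Measure ℝ} [IsFiniteMeasure ψ] {M : ℝ}
    (hM : ψ (Set.Icc (-M) M)ᶜ = 0) {f : ℝ → ℝ} (hf : Continuous f) : Integrable f ψ := by
  have hae : ∀ᵐ x ∂ψ, x ∈ Set.Icc (-M) M := hM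
  rw [← Measure.restrict_eq_self_of_ae_mem hae]
  exact hf.continuousOn.integrableOn_compact isCompact_Icc

/-- Integration of polynomials as a linear functional. -/
noncomputable def polyIntegral (ψ : Measure ℝ) (h : ∀ P : ℝ[X], Integrable (fun x => P.eval x) ψ) :
    ℝ[X] →ₗ[ℝ] ℝ where
  toFun P := ∫ x, P.eval x ∂ψ
  map_add' P R := by
    simp only [eval_add]
    exact integral_add (h P) (h R)
  map_smul' c P := by
    simp only [eval_smul, smul_eq_mul, RingHom.id_apply]
    exact integral_const_mul c _

theorem exists_polynomial_seq (M : ℝ) {f : ℝ → ℝ} (hf : Continuous f) :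
    ∃ P : ℕ → ℝ[X], (∀ n, ∀ x ∈ Set.Icc (-M) M, |(P n).eval x - f x| ≤ 1) ∧
      ∀ x ∈ Set.Icc (-M) M, Tendsto (fun n => (P n).eval x) atTop (𝓝 (f x)) := by
  have h : ∀ n : ℕ, ∃ P : ℝ[X], ∀ x ∈ Set.Icc (-M) M, |P.eval x - f x| < 1 / ((n : ℝ) + 1) :=
    fun n => exists_polynomial_near_of_continuousOn _ _ f hf.continuousOn _
      Nat.one_div_pos_of_nat
  choose P hP using h
  refine ⟨P, fun n x hx => (hP n x hx).le.trans ?_, fun x hx => ?_⟩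
  · rw [div_le_one (by positivity)]
    have : (0 : ℝ) ≤ n := n.cast_nonneg
    linarith
  · rw [tendsto_iff_dist_tendsto_zero]
    refine squeeze_zero (fun _ => dist_nonneg) (fun n => ?_)
      (tendsto_one_div_add_atTop_nhds_zero_nat (𝕜 := ℝ))
    rw [Real.dist_eq]
    exact (hP n x hx).le

/-- The general F lets one limit theorem serve both linear integrands and quadratic ones such as (x
- st)f(t)². -/
theorem tendsto_integral_polynomial_seq {ψ : Measure ℝ} [IsFiniteMeasure ψ] {M : ℝ}
    (hM : ψ (Set.Icc (-M) M)ᶜ = 0) {f : ℝ → ℝ} (hf : Continuous f) {P : ℕ → ℝ[X]}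
    (hP1 : ∀ n, ∀ x ∈ Set.Icc (-M) M, |(P n).eval x - f x| ≤ 1)
    (hP2 : ∀ x ∈ Set.Icc (-M) M, Tendsto (fun n => (P n).eval x) atTop (𝓝 (f x)))
    {F : ℝ → ℝ → ℝ} (hF : Continuous (fun y : ℝ × ℝ => F y.1 y.2)) :
    Tendsto (fun n => ∫ x, F x ((P n).eval x) ∂ψ) atTop (𝓝 (∫ x, F x (f x) ∂ψ)) := by
  have hae : ∀ᵐ x ∂ψ, x ∈ Set.Icc (-M) M := hM
  obtain ⟨B, hB⟩ := (isCompact_Icc (a := -M) (b := M)).exists_bound_of_continuousOn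
    hf.continuousOn
  obtain ⟨D, hD⟩ := ((isCompact_Icc (a := -M) (b := M)).prod
    (isCompact_Icc (a := -(B + 1)) (b := B + 1))).exists_bound_of_continuousOn hF.continuousOn
  refine tendsto_integral_of_dominated_convergence (fun _ => D) (fun n => ?_)
    (integrable_const D) (fun n => ?_) ?_
  · exact (hF.comp (continuous_id.prodMk (P n).continuous)).aestronglyMeasurable
  · filter_upwards [hae] with x hx
    refine hD (x, (P n).eval x) ⟨hx, abs_le.mp ?_⟩
    have h1 := hP1 n x hx
    have h2 := hB x hx
    rw [Real.norm_eq_abs] at h2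
    have h3 := abs_add_le ((P n).eval x - f x) (f x)
    rw [sub_add_cancel] at h3
    linarith
  · filter_upwards [hae] with x hx
    exact ((hF.comp (continuous_const.prodMk continuous_id)).tendsto (f x)).comp (hP2 x hx)

theorem measure_eq_of_polynomial_integrals {ψ ψ' : Measure ℝ} [IsFiniteMeasure ψ]
    [IsFiniteMeasure ψ'] {M : ℝ} (hM : ψ (Set.Icc (-M) M)ᶜ = 0) (hM' : ψ' (Set.Icc (-M) M)ᶜ = 0)
    (h : ∀ P : ℝ[X], ∫ x, P.eval x ∂ψ = ∫ x, P.eval x ∂ψ') : ψ = ψ' := by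
  refine ext_of_forall_integral_eq_of_IsFiniteMeasure fun f => ?_
  obtain ⟨P, hP1, hP2⟩ := exists_polynomial_seq M f.continuous
  have h1 := tendsto_integral_polynomial_seq hM f.continuous hP1 hP2 (F := fun _ y => y)
    continuous_snd
  have h2 := tendsto_integral_polynomial_seq hM' f.continuous hP1 hP2 (F := fun _ y => y)
    continuous_snd
  simp only [h] at h1
  exact tendsto_nhds_unique h1 h2

/-- By approximation the form may be tested on the positive part (st - x)⁺, where it equals -∫ ((st
- x)⁺)³ dψ; being nonnegative, it vanishes. -/
theorem measure_lt_eq_zero_of_form_nonneg {ψ : Measure ℝ} [IsFiniteMeasure ψ] {M : ℝ}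
    (hM : ψ (Set.Icc (-M) M)ᶜ = 0) {x s : ℝ}
    (h : ∀ g : ℝ[X], 0 ≤ ∫ t, (x - s * t) * g.eval t ^ 2 ∂ψ) : ψ {t | x < s * t} = 0 := by
  have hf : Continuous (fun t => max (s * t - x) 0) := by fun_prop
  obtain ⟨P, hP1, hP2⟩ := exists_polynomial_seq M hf
  have h1 := tendsto_integral_polynomial_seq hM hf hP1 hP2
    (F := fun t y => (x - s * t) * y ^ 2) (by fun_prop)
  have h2 : 0 ≤ ∫ t, (x - s * t) * max (s * t - x) 0 ^ 2 ∂ψ :=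
    ge_of_tendsto' h1 fun n => h (P n)
  have h3 : ∀ t, (x - s * t) * max (s * t - x) 0 ^ 2 = -(max (s * t - x) 0 ^ 3) := by
    intro t
    rcases le_total (s * t - x) 0 with ht | ht
    · rw [max_eq_right ht]; ring
    · rw [max_eq_left ht]; ring
  simp only [h3, integral_neg] at h2
  have h4 : (∫ t, max (s * t - x) 0 ^ 3 ∂ψ) = 0 :=
    le_antisymm (by linarith) (integral_nonneg fun t => by positivity)
  rw [integral_eq_zero_iff_of_nonneg (fun t => by positivity)
    (integrable_of_continuous hM (by fun_prop))] at h4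
  rw [measure_eq_zero_iff_ae_notMem]
  filter_upwards [h4] with t ht hlt
  have : 0 < max (s * t - x) 0 := lt_max_of_lt_left (sub_pos.mpr hlt)
  exact (pow_pos this 3).ne' ht

end measure

/-! ### The Chebyshev formula, and growth of Q_n(1) -/

theorem eigenfun_eq_eval (r₀ : ℝ) {p₀ p q : ℝ} (hp₀ : 0 < p₀) (hp : 0 < p) (hq : 0 < q) (n : ℕ)
    (x : ℝ) : eigenfun r₀ p₀ p q n x = (qPoly r₀ p₀ p q n).eval x := by
  -- Writing p and q as squares makes every square root rational in u and w, so that the recurrences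
  -- become field identities.
  obtain ⟨u, hu, rfl⟩ : ∃ u : ℝ, 0 < u ∧ p = u ^ 2 :=
    ⟨√p, Real.sqrt_pos.mpr hp, (Real.sq_sqrt hp.le).symm⟩
  obtain ⟨w, hw, rfl⟩ : ∃ w : ℝ, 0 < w ∧ q = w ^ 2 :=
    ⟨√q, Real.sqrt_pos.mpr hq, (Real.sq_sqrt hq.le).symm⟩
  have e1 : √(w ^ 2 / u ^ 2) = w / u := by rw [← div_pow, Real.sqrt_sq (by positivity)]
  have e2 : √(u ^ 2 / w ^ 2) = u / w := by rw [← div_pow, Real.sqrt_sq (by positivity)]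
  have e3 : √(u ^ 2 * w ^ 2) = u * w := by rw [← mul_pow, Real.sqrt_sq (by positivity)]
  induction n using Nat.twoStepInduction with
  | zero =>
    rw [eval_qPoly_zero]
    simp [eigenfun]
    field_simp
    ring
  | one =>
    apply mul_left_cancel₀ hp₀.ne'
    rw [mul_eval_qPoly_one _ _ _ hp₀, eigenfun, e1, e2, e3]
    simp
    field_simp
    ring
  | more n ih0 ih1 =>
    apply mul_left_cancel₀ hp.ne'
    rw [mul_eval_qPoly_add_two _ _ _ hp, ← ih0, ← ih1]
    simp only [eigenfun, e1, e2, e3]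
    have hT := Polynomial.Chebyshev.T_add_two ℝ (n : ℤ)
    have hU := Polynomial.Chebyshev.U_add_two ℝ (n : ℤ)
    have hU' := Polynomial.Chebyshev.U_add_two ℝ ((n : ℤ) - 1)
    have c1 : ((n + 2 : ℕ) : ℤ) = (n : ℤ) + 2 := by push_cast; ring
    have c2 : ((n + 1 : ℕ) : ℤ) = (n : ℤ) + 1 := by push_cast; ring
    have c3 : (n : ℤ) + 2 - 1 = (n : ℤ) - 1 + 2 := by ring
    have c4 : (n : ℤ) + 1 - 1 = (n : ℤ) - 1 + 1 := by ring
    rw [c1, c2, c3, c4, hT, hU, hU']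
    simp only [Polynomial.eval_sub, Polynomial.eval_mul, Polynomial.eval_X, Polynomial.eval_ofNat]
    generalize (Polynomial.Chebyshev.T ℝ (n : ℤ)).eval (x / (2 * (u * w))) = t0
    generalize (Polynomial.Chebyshev.T ℝ ((n : ℤ) + 1)).eval (x / (2 * (u * w))) = t1
    generalize (Polynomial.Chebyshev.U ℝ (n : ℤ)).eval (x / (2 * (u * w))) = s0
    generalize (Polynomial.Chebyshev.U ℝ ((n : ℤ) + 1)).eval (x / (2 * (u * w))) = s1
    generalize (Polynomial.Chebyshev.U ℝ ((n : ℤ) - 1)).eval (x / (2 * (u * w))) = v0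
    generalize (Polynomial.Chebyshev.U ℝ ((n : ℤ) - 1 + 1)).eval (x / (2 * (u * w))) = v1
    rw [pow_succ (w / u) (n + 1), pow_succ (w / u) n]
    generalize (w / u) ^ n = k
    field_simp
    ring

/-- At x = 1 the recurrence multiplies successive increments by q/p ≥ 1, so none falls below the
first, which is q₀/p₀. -/
theorem one_add_mul_le_eval_qPoly_one {r₀ p₀ p q : ℝ} (hp₀ : 0 < p₀) (hp : 0 < p)
    (hpq : p + q = 1) (hq₀ : 0 < 1 - r₀ - p₀) (hp_half : p ≤ 1 / 2) (n : ℕ) :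
    1 + n * ((1 - r₀ - p₀) / p₀) ≤ (qPoly r₀ p₀ p q n).eval 1 := by
  set d := (1 - r₀ - p₀) / p₀ with hd
  have hd0 : 0 < d := div_pos hq₀ hp₀
  have hinc : ∀ n, d ≤ (qPoly r₀ p₀ p q (n + 1)).eval 1 - (qPoly r₀ p₀ p q n).eval 1 := by
    intro n
    induction n with
    | zero =>
      have h := mul_eval_qPoly_one r₀ (p := p) q 1 hp₀
      rw [eval_qPoly_zero, hd, div_le_iff₀ hp₀]
      simp only [zero_add]
      linarith
    | succ n ih =>
      have h := mul_eval_qPoly_add_two r₀ (p₀ := p₀) q 1 hp n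
      have h2 : p * ((qPoly r₀ p₀ p q (n + 2)).eval 1 - (qPoly r₀ p₀ p q (n + 1)).eval 1) =
          q * ((qPoly r₀ p₀ p q (n + 1)).eval 1 - (qPoly r₀ p₀ p q n).eval 1) := by
        rw [mul_sub, h]
        linear_combination (-(qPoly r₀ p₀ p q (n + 1)).eval 1) * hpq
      have h3 : p ≤ q := by linarith
      refine ih.trans (le_of_mul_le_mul_left ?_ hp)
      rw [h2]
      exact mul_le_mul_of_nonneg_right h3 (hd0.le.trans ih)
  induction n with
  | zero => simp [eval_qPoly_zero]
  | succ n ih =>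
    have := hinc n
    push_cast
    linarith

/-! ### Support of ψ and zeros of Q_n -/

section orth
open Polynomial
variable {r₀ p₀ p q : ℝ} {ψ : Measure ℝ} [IsFiniteMeasure ψ] {M : ℝ}
  (hM : ψ (Set.Icc (-M) M)ᶜ = 0)
  (hψ : ∀ i j, ∫ x, (qPoly r₀ p₀ p q i).eval x * (qPoly r₀ p₀ p q j).eval x ∂ψ =
        if i = j then (weight p₀ p q j)⁻¹ else 0)
include hM hψ

theorem polyIntegral_qPoly (i j : ℕ) :
    polyIntegral ψ (fun P => integrable_of_continuous hM P.continuous)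
      (qPoly r₀ p₀ p q i * qPoly r₀ p₀ p q j) = if i = j then (weight p₀ p q j)⁻¹ else 0 := by
  rw [← hψ]
  simp only [← eval_mul]
  rfl

theorem measure_lt_eq_zero_of_supersolution (hr₀ : 0 ≤ r₀) (hp₀ : 0 < p₀) (hp : 0 < p)
    (hq : 0 < q) {x s : ℝ} (hs : s = 1 ∨ s = -1) {v : ℕ → ℝ} (hv : ∀ n, 0 < v n)
    (h0 : r₀ * v 0 + p₀ * v 1 ≤ x * v 0)
    (h1 : ∀ n, q * v n + p * v (n + 2) ≤ x * v (n + 1)) : ψ {t | x < s * t} = 0 := by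
  refine measure_lt_eq_zero_of_form_nonneg hM fun g => ?_
  refine (functional_form_nonneg (polyIntegral_qPoly hM hψ) hr₀ hp₀ hp hq hs hv h0 h1 g).trans_eq ?_
  refine integral_congr_ae (.of_forall fun t => ?_)
  simp

theorem measure_Ioi_eq_zero_of_eval_pos (hr₀ : 0 ≤ r₀) (hp₀ : 0 < p₀) (hp : 0 < p)
    (hq : 0 < q) {x : ℝ} (hx : ∀ n, 0 < (qPoly r₀ p₀ p q n).eval x) : ψ (Set.Ioi x) = 0 := by
  have := measure_lt_eq_zero_of_supersolution hM hψ hr₀ hp₀ hp hq (x := x) (s := 1) (.inl rfl) hx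
    (by rw [mul_eval_qPoly_one _ _ _ hp₀, eval_qPoly_zero]; linarith)
    (fun n => by rw [mul_eval_qPoly_add_two _ _ _ hp]; linarith)
  simp only [one_mul] at this
  exact this

/-- Row sums of ℙ are at most 1, so the constant 1 is a supersolution at x = 1; the two signs of s
bound the two ends. -/
theorem measure_compl_Icc_eq_zero (hr₀ : 0 ≤ r₀) (hp₀ : 0 < p₀) (hp : 0 < p)
    (hq : 0 < q) (hpq : p + q = 1) (hq₀ : 0 < 1 - r₀ - p₀) : ψ (Set.Icc (-1) 1)ᶜ = 0 := by
  have h := fun s hs => measure_lt_eq_zero_of_supersolution hM hψ hr₀ hp₀ hp hq (x := 1) (s := s)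
    (v := fun _ => 1) hs (fun _ => one_pos) (by linarith) (fun n => by linarith)
  refine measure_mono_null (fun t ht => ?_) (measure_union_null (h 1 (.inl rfl)) (h (-1) (.inr rfl)))
  by_contra hcon
  simp only [Set.mem_union, Set.mem_ofPred_eq, not_or, not_lt] at hcon
  exact ht ⟨by linarith, by linarith⟩

/-- If Q_n = (X - x)R, then Q_n is orthogonal to R, of lower degree, so ∫ (x - t)R² dψ = 0 with a
nonnegative integrand. Hence Q_n = 0 almost everywhere, against ∫ Q_n² dψ > 0. -/
theorem eval_qPoly_ne_zero_of_ae_le (hp₀ : 0 < p₀) (hp : 0 < p) (hq : 0 < q) {x : ℝ}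
    (hx : ∀ᵐ t ∂ψ, t ≤ x) (n : ℕ) : (qPoly r₀ p₀ p q n).eval x ≠ 0 := by
  intro h0
  obtain ⟨R, hR⟩ := dvd_iff_isRoot.mpr h0
  have hL := polyIntegral_qPoly hM hψ
  have hcoeff := coeff_qPoly r₀ q hp₀ hp n
  have hRn : ∀ m, n ≤ m → R.coeff m = 0 := by
    intro m hm
    by_cases hR0 : R = 0
    · simp [hR0]
    apply coeff_eq_zero_of_natDegree_lt
    have h1 : (qPoly r₀ p₀ p q n).natDegree = 1 + R.natDegree := by
      rw [hR, natDegree_mul (X_sub_C_ne_zero x) hR0, natDegree_X_sub_C]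
    have h2 : (qPoly r₀ p₀ p q n).natDegree ≤ n :=
      natDegree_le_iff_coeff_eq_zero.mpr hcoeff.1
    omega
  have h1 := functional_qPoly_mul_eq_zero hL hp₀ hp n R hRn
  change ∫ t, eval t (qPoly r₀ p₀ p q n * R) ∂ψ = 0 at h1
  have h2 : ∫ t, (x - t) * eval t R ^ 2 ∂ψ = 0 := by
    rw [← neg_eq_zero, ← integral_neg, ← h1]
    refine integral_congr_ae (.of_forall fun t => ?_)
    simp only [hR, eval_mul, eval_sub, eval_X, eval_C]
    ring
  rw [integral_eq_zero_iff_of_nonneg_ae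
    (hx.mono fun t ht => mul_nonneg (sub_nonneg.mpr ht) (sq_nonneg _))
    (integrable_of_continuous hM (by fun_prop))] at h2
  have h3 := hψ n n
  rw [if_pos rfl] at h3
  have hw := weight_pos hp₀ hp hq n
  refine (inv_pos.mpr hw).ne' (h3.symm.trans ?_)
  refine (integral_congr_ae (g := fun _ => 0) (h2.mono fun t ht => ?_)).trans (by simp)
  simp only [Pi.zero_apply] at ht
  simp only [hR, eval_mul, eval_sub, eval_X, eval_C]
  linear_combination (x - t) * ht

theorem eval_qPoly_pos_of_ae_le (hp₀ : 0 < p₀) (hp : 0 < p) (hq : 0 < q) (hpq : p + q = 1)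
    (hq₀ : 0 < 1 - r₀ - p₀) (hp_half : p ≤ 1 / 2) {x : ℝ} (hx1 : x ≤ 1)
    (hx : ∀ᵐ t ∂ψ, t ≤ x) (n : ℕ) : 0 < (qPoly r₀ p₀ p q n).eval x := by
  by_contra! hcon
  have h1 : 0 ≤ (qPoly r₀ p₀ p q n).eval 1 :=
    le_trans (by positivity) (one_add_mul_le_eval_qPoly_one hp₀ hp hpq hq₀ hp_half n)
  obtain ⟨y, hy, hy0⟩ := intermediate_value_Icc hx1
    (qPoly r₀ p₀ p q n).continuous.continuousOn ⟨hcon, h1⟩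
  exact eval_qPoly_ne_zero_of_ae_le hM hψ hp₀ hp hq (hx.mono fun t ht => ht.trans hy.1) n hy0

end orth

theorem isOrthogonalityMeasure_iff {r₀ p₀ p q : ℝ} (hp₀ : 0 < p₀) (hp : 0 < p) (hq : 0 < q)
    (ψ : Measure ℝ) : IsOrthogonalityMeasure r₀ p₀ p q ψ ↔ ψ (Set.Icc (-1) 1)ᶜ = 0 ∧
      ∀ i j, ∫ x, (qPoly r₀ p₀ p q i).eval x * (qPoly r₀ p₀ p q j).eval x ∂ψ =
        if i = j then (weight p₀ p q j)⁻¹ else 0 := by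
  unfold IsOrthogonalityMeasure
  simp only [eigenfun_eq_eval r₀ hp₀ hp hq]
  refine and_congr_right fun _ => forall₂_congr fun i j => ?_
  have hw := weight_pos hp₀ hp hq j
  split_ifs
  · rw [← one_div, eq_div_iff hw.ne', mul_comm]
  · simp [hw.ne']

theorem IsOrthogonalityMeasure.isFiniteMeasure {r₀ p₀ p q : ℝ} (hp₀ : 0 < p₀) (hp : 0 < p)
    (hq : 0 < q) {ψ : Measure ℝ} (h : IsOrthogonalityMeasure r₀ p₀ p q ψ) :
    IsFiniteMeasure ψ ∧ ψ ≠ 0 := by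
  have := ((isOrthogonalityMeasure_iff hp₀ hp hq ψ).mp h).2 0 0
  simp only [eval_qPoly_zero, weight] at this
  simp at this
  refine ⟨⟨?_⟩, ?_⟩
  -- On a measure of infinite mass the integral of 1 takes the default value 0, which contradicts
  -- the normalisation.
  · by_contra hcon
    simp only [not_lt, top_le_iff] at hcon
    simp [Measure.real, hcon] at this
  · rintro rfl
    simp at this

theorem exists_isOrthogonalityMeasure {r₀ p₀ p q : ℝ} (hr₀ : 0 ≤ r₀) (hp₀ : 0 < p₀) (hp : 0 < p)
    (hq : 0 < q) (hpq : p + q = 1) (hq₀ : 0 < 1 - r₀ - p₀) :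
    ∃ ψ, IsOrthogonalityMeasure r₀ p₀ p q ψ := by
  obtain ⟨ψ, _, ⟨M, hM⟩, h⟩ := exists_qPoly_measure r₀ hp₀ hp hq
  exact ⟨ψ, (isOrthogonalityMeasure_iff hp₀ hp hq ψ).mpr
    ⟨measure_compl_Icc_eq_zero hM h hr₀ hp₀ hp hq hpq hq₀, h⟩⟩

open Polynomial in
-- As Q_0 = 1, the relations with i = 0 fix ∫ Q_j, hence all polynomial integrals, and these
-- determine a finite measure on [-1, 1].
theorem IsOrthogonalityMeasure.unique {r₀ p₀ p q : ℝ} (hp₀ : 0 < p₀) (hp : 0 < p)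
    (hq : 0 < q) {ψ ψ' : Measure ℝ} (h : IsOrthogonalityMeasure r₀ p₀ p q ψ)
    (h' : IsOrthogonalityMeasure r₀ p₀ p q ψ') : ψ' = ψ := by
  have := (h.isFiniteMeasure hp₀ hp hq).1
  have := (h'.isFiniteMeasure hp₀ hp hq).1
  have hM := ((isOrthogonalityMeasure_iff hp₀ hp hq ψ).mp h)
  have hM' := ((isOrthogonalityMeasure_iff hp₀ hp hq ψ').mp h')
  refine measure_eq_of_polynomial_integrals hM'.1 hM.1 fun P => ?_
  have hL := polyIntegral_qPoly hM.1 hM.2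
  have hL' := polyIntegral_qPoly hM'.1 hM'.2
  change polyIntegral ψ' (fun P => integrable_of_continuous hM'.1 P.continuous) P =
    polyIntegral ψ (fun P => integrable_of_continuous hM.1 P.continuous) P
  obtain ⟨c, hc⟩ := exists_eq_sum_qPoly r₀ q hp₀ hp (P.natDegree + 1) P
    (fun m hm => coeff_eq_zero_of_natDegree_lt hm)
  rw [hc]
  simp only [map_sum, map_smul]
  refine Finset.sum_congr rfl fun i _ => ?_
  have e := hL 0 i
  have e' := hL' 0 i
  simp only [qPoly, one_mul] at e e'
  rw [e, e']

/-- The supremum `η` of the support, characterised through positivity of the `Q_j`. -/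
theorem IsOrthogonalityMeasure.exists_isLUB_support {r₀ p₀ p q : ℝ} (hr₀ : 0 ≤ r₀) (hp₀ : 0 < p₀)
    (hp : 0 < p) (hq : 0 < q) (hpq : p + q = 1) (hq₀ : 0 < 1 - r₀ - p₀) (hp_half : p ≤ 1 / 2)
    {ψ : Measure ℝ} (h : IsOrthogonalityMeasure r₀ p₀ p q ψ) :
    ∃ η, IsLUB ψ.support η ∧ η ≤ 1 ∧
      (∀ x, η ≤ x → x ≤ 1 → ∀ n, 0 < (qPoly r₀ p₀ p q n).eval x) ∧
      ∀ x, (∀ n, 0 < (qPoly r₀ p₀ p q n).eval x) → η ≤ x := by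
  obtain ⟨_, hne⟩ := h.isFiniteMeasure hp₀ hp hq
  obtain ⟨hM, hψ⟩ := (isOrthogonalityMeasure_iff hp₀ hp hq ψ).mp h
  have hsub : ψ.support ⊆ Set.Icc (-1) 1 := Measure.support_subset_of_isClosed isClosed_Icc hM
  have hlub := isLUB_csSup (Measure.nonempty_support hne) ⟨1, fun y hy => (hsub hy).2⟩
  refine ⟨_, hlub, hlub.2 fun y hy => (hsub hy).2, fun x hx hx1 n => ?_, fun x hx => ?_⟩
  · refine eval_qPoly_pos_of_ae_le hM hψ hp₀ hp hq hpq hq₀ hp_half hx1 ?_ n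
    filter_upwards [Measure.support_mem_ae (μ := ψ)] with t ht
    exact (hlub.1 ht).trans hx
  · have h0 := measure_Ioi_eq_zero_of_eval_pos hM hψ hr₀ hp₀ hp hq hx
    refine hlub.2 fun y hy => ?_
    have : ψ.support ⊆ Set.Iic x := Measure.support_subset_of_isClosed isClosed_Iic (by
      rw [mem_ae_iff, Set.compl_Iic]; exact h0)
    exact this hy

/-! ### Sign of Q_n(x) for x below 1 -/

/-- For p = q, a nonnegative sequence Q_n(x) is concave from its first increment on, hence
nondecreasing and at least 1. Its increments then drop by at least 2(1 - x) each time and become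
negative. -/
theorem not_forall_eval_qPoly_nonneg {r₀ p₀ p q x : ℝ} (hp : 0 < p) (hq : p = q)
    (hpq : p + q = 1) (hx : x < 1) :
    ¬ ∀ n, 0 ≤ (qPoly r₀ p₀ p q n).eval x := by
  intro h
  set Q : ℕ → ℝ := fun n => (qPoly r₀ p₀ p q n).eval x with hQ
  have hp2 : p = 1 / 2 := by linarith
  have hrec : ∀ n, Q (n + 2) - Q (n + 1) = Q (n + 1) - Q n - 2 * (1 - x) * Q (n + 1) := by
    intro n
    have h1 := mul_eval_qPoly_add_two r₀ (p₀ := p₀) q x hp n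
    rw [← hq, hp2] at h1
    simp only [hQ, ← hq, hp2]
    linarith
  have hdec : ∀ n k, Q (n + k + 1) - Q (n + k) ≤ Q (n + 1) - Q n := by
    intro n k
    induction k with
    | zero => rfl
    | succ k ih =>
      have := hrec (n + k)
      have := mul_nonneg (sub_nonneg.mpr hx.le) (h (n + k + 1))
      change 0 ≤ (1 - x) * Q (n + k + 1) at this
      change Q (n + k + 2) - Q (n + k + 1) ≤ _
      linarith
  have hinc : ∀ n, 0 ≤ Q (n + 1) - Q n := by
    intro n
    by_contra! hneg
    have hlin : ∀ k : ℕ, Q (n + k) ≤ Q n + k * (Q (n + 1) - Q n) := by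
      intro k
      induction k with
      | zero => simp
      | succ k ih =>
        have := hdec n k
        push_cast
        change Q (n + k + 1) ≤ _
        linarith
    obtain ⟨k, hk⟩ := exists_nat_gt (Q n / (Q n - Q (n + 1)))
    rw [div_lt_iff₀ (by linarith)] at hk
    have h1 := hlin k
    have h2 : 0 ≤ Q (n + k) := h _
    linarith
  have hone : ∀ n, 1 ≤ Q n := by
    intro n
    induction n with
    | zero => exact (eval_qPoly_zero r₀ p₀ p q x).ge
    | succ n ih => linarith [hinc n]
  have hlin : ∀ k : ℕ, Q (k + 1) - Q k ≤ Q 1 - Q 0 - k * (2 * (1 - x)) := by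
    intro k
    induction k with
    | zero => simp
    | succ k ih =>
      have h1 := hrec k
      have h2 := mul_le_mul_of_nonneg_left (hone (k + 1)) (sub_nonneg.mpr hx.le)
      push_cast
      change Q (k + 2) - Q (k + 1) ≤ _
      linarith
  obtain ⟨k, hk⟩ := exists_nat_gt ((Q 1 - Q 0) / (2 * (1 - x)))
  rw [div_lt_iff₀ (by linarith)] at hk
  linarith [hlin k, hinc k]

theorem exists_lt_one_forall_eval_qPoly_pos {r₀ p₀ p q : ℝ} (hp₀ : 0 < p₀)
    (hp : 0 < p) (hpq : p + q = 1) (hq₀ : 0 < 1 - r₀ - p₀) (hp_half : p < 1 / 2) :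
    ∃ x < 1, ∀ n, 0 < (qPoly r₀ p₀ p q n).eval x := by
  -- For 1 < c < q/p one has pc + q/c < 1, and c < (1 - r₀)/p₀ gives r₀ + cp₀ < 1. The larger of
  -- these two numbers is an x < 1 for which Q_{n+1}(x) ≥ c Q_n(x) is preserved by the recurrence
  -- and holds at n = 0.
  have h1 : 1 < min (q / p) ((1 - r₀) / p₀) := by
    rw [lt_min_iff, one_lt_div hp, one_lt_div hp₀]
    constructor <;> linarith
  obtain ⟨c, hc1, hc2⟩ := exists_between h1
  rw [lt_min_iff, lt_div_iff₀ hp, lt_div_iff₀ hp₀] at hc2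
  obtain ⟨hcq, hcr⟩ := hc2
  have hc0 : 0 < c := by linarith
  have hx1 : p * c + q / c < 1 := by
    have : p * c + q / c - 1 = (c - 1) * (c * p - q) / c := by
      field_simp
      linear_combination c * hpq
    have h2 : (c - 1) * (c * p - q) / c < 0 :=
      div_neg_of_neg_of_pos (mul_neg_of_pos_of_neg (by linarith) (by linarith)) hc0
    linarith
  refine ⟨max (p * c + q / c) (r₀ + c * p₀), max_lt hx1 (by linarith), fun n => ?_⟩
  set x := max (p * c + q / c) (r₀ + c * p₀)
  have hxa : p * c + q / c ≤ x := le_max_left _ _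
  have hxb : r₀ + c * p₀ ≤ x := le_max_right _ _
  have hq : 0 < q := by linarith
  have key : ∀ n, 0 < (qPoly r₀ p₀ p q n).eval x ∧
      c * (qPoly r₀ p₀ p q n).eval x ≤ (qPoly r₀ p₀ p q (n + 1)).eval x := by
    intro n
    induction n with
    | zero =>
      rw [eval_qPoly_zero]
      refine ⟨one_pos, le_of_mul_le_mul_left ?_ hp₀⟩
      rw [zero_add, mul_eval_qPoly_one _ _ _ hp₀]
      linarith
    | succ n ih =>
      have hpos : 0 < (qPoly r₀ p₀ p q (n + 1)).eval x :=
        (mul_pos hc0 ih.1).trans_le ih.2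
      refine ⟨hpos, le_of_mul_le_mul_left ?_ hp⟩
      rw [mul_eval_qPoly_add_two _ _ _ hp]
      have h3 := mul_le_mul_of_nonneg_right hxa hpos.le
      have h4 : q * (qPoly r₀ p₀ p q n).eval x ≤ q / c * (qPoly r₀ p₀ p q (n + 1)).eval x := by
        rw [div_mul_eq_mul_div, le_div_iff₀ hc0]
        nlinarith [mul_le_mul_of_nonneg_left ih.2 hq.le]
      linarith
  exact (key n).1

/-- A first zero Q_{n+1}(x) = 0 would force p Q_{n+2}(x) = -q Q_n(x) < 0. -/
theorem eval_qPoly_pos_of_nonneg {r₀ p₀ p q x : ℝ} (hp : 0 < p) (hq : 0 < q)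
    (h : ∀ n, 0 ≤ (qPoly r₀ p₀ p q n).eval x) (n : ℕ) : 0 < (qPoly r₀ p₀ p q n).eval x := by
  induction n with
  | zero => rw [eval_qPoly_zero]; exact one_pos
  | succ n ih =>
    refine (h (n + 1)).lt_of_ne fun h0 => ?_
    have h1 := mul_eval_qPoly_add_two r₀ (p₀ := p₀) q x hp n
    rw [← h0] at h1
    have h2 := mul_nonneg hp.le (h (n + 2))
    have h3 := mul_pos hq ih
    linarith

/-! ### The walk, its law and certain absorption -/

/-- One step of the walk, acting on distributions restricted to the states `0, 1, 2, …`. -/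
noncomputable def step (r₀ p₀ p q : ℝ) (μ : ℕ → ℝ) : ℕ → ℝ
  | 0 => r₀ * μ 0 + q * μ 1
  | j + 1 => up p₀ p j * μ j + q * μ (j + 2)

/-- The transition matrix acting on functions. -/
noncomputable def act (r₀ p₀ p q : ℝ) (v : ℕ → ℝ) : ℕ → ℝ
  | 0 => r₀ * v 0 + p₀ * v 1
  | j + 1 => q * v j + p * v (j + 2)

theorem law_succ_none (r₀ p₀ p q : ℝ) (α : ℕ → ℝ) (n : ℕ) :
    law r₀ p₀ p q α (n + 1) none =
      law r₀ p₀ p q α n none + (1 - r₀ - p₀) * law r₀ p₀ p q α n (some 0) := by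
  rw [law, tsum_eq_sum (s := {none, some 0})]
  · rw [Finset.sum_pair (by simp)]
    simp only [fullTransition]
    ring
  · rintro (_ | _ | j) hx
    · simp at hx
    · simp at hx
    · simp [fullTransition]

theorem law_succ_some (r₀ p₀ p q : ℝ) (α : ℕ → ℝ) (n j : ℕ) :
    law r₀ p₀ p q α (n + 1) (some j) =
      step r₀ p₀ p q (fun i => law r₀ p₀ p q α n (some i)) j := by
  rw [law]
  rcases j with _ | j
  · rw [tsum_eq_sum (s := {some 0, some 1})]
    · rw [Finset.sum_pair (by simp)]
      simp only [fullTransition, transition, step]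
      simp
      ring
    · rintro (_ | _ | _ | j) hx
      · simp [fullTransition]
      · simp at hx
      · simp at hx
      · simp [fullTransition, transition]
  · rw [tsum_eq_sum (s := {some j, some (j + 2)})]
    · rw [Finset.sum_pair (by simp)]
      rcases j with _ | j
      · simp [fullTransition, transition, step, up]
        ring
      · simp only [fullTransition, transition, step, up]
        rw [if_neg (by omega)]
        simp only [if_true]
        ring
    · rintro (_ | _ | i) hx
      · simp [fullTransition]
      · simp only [Finset.mem_insert, Finset.mem_singleton, Option.some.injEq, not_or] at hx
        simp only [fullTransition, transition]
        rw [if_neg (by omega), if_neg (by omega), mul_zero]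
      · simp only [Finset.mem_insert, Finset.mem_singleton, Option.some.injEq, not_or] at hx
        simp only [fullTransition, transition]
        rw [if_neg (by omega), if_neg (by omega), mul_zero]

/-- `step` and `act` are transposes of each other; truncation at N leaves only the flux between N
and N + 1. -/
theorem sum_step_mul (r₀ p₀ p q : ℝ) (μ v : ℕ → ℝ) (N : ℕ) :
    ∑ j ∈ Finset.range (N + 1), step r₀ p₀ p q μ j * v j =
      ∑ j ∈ Finset.range (N + 1), μ j * act r₀ p₀ p q v j +
        (q * μ (N + 1) * v N - up p₀ p N * μ N * v (N + 1)) := by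
  induction N with
  | zero =>
    simp [step, act, up]
    ring
  | succ N ih =>
    rw [Finset.sum_range_succ, ih, Finset.sum_range_succ _ (N + 1)]
    simp only [step, act, up]
    ring

theorem act_one (r₀ p₀ : ℝ) {p q : ℝ} (hpq : p + q = 1) (j : ℕ) :
    act r₀ p₀ p q (fun _ => 1) j = 1 - if j = 0 then 1 - r₀ - p₀ else 0 := by
  cases j <;> simp [act] <;> linarith

section walk
variable {r₀ p₀ p q : ℝ}

theorem step_nonneg (hr₀ : 0 ≤ r₀) (hp₀ : 0 < p₀) (hp : 0 < p) (hq : 0 < q) {μ : ℕ → ℝ}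
    (hμ : ∀ j, 0 ≤ μ j) (j : ℕ) : 0 ≤ step r₀ p₀ p q μ j := by
  cases j with
  | zero =>
    have := hμ 0
    have := hμ 1
    simp only [step]
    positivity
  | succ j =>
    have := hμ j
    have := hμ (j + 2)
    have := up_pos hp₀ hp j
    simp only [step]
    positivity

theorem tendsto_up_mul {μ : ℕ → ℝ} (hμ : Tendsto μ atTop (𝓝 0)) :
    Tendsto (fun N => up p₀ p N * μ N) atTop (𝓝 0) := by
  rw [← tendsto_add_atTop_iff_nat 1]
  simpa [up] using ((tendsto_add_atTop_iff_nat 1).mpr hμ).const_mul p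

theorem hasSum_step_mul (hr₀ : 0 ≤ r₀) (hp₀ : 0 < p₀) (hp : 0 < p) (hq : 0 < q) {μ v : ℕ → ℝ}
    (hμ : ∀ j, 0 ≤ μ j) (hμ0 : Tendsto μ atTop (𝓝 0)) (hv : ∀ j, v j ∈ Set.Icc (0 : ℝ) 1) {s : ℝ}
    (hs : HasSum (fun j => μ j * act r₀ p₀ p q v j) s) :
    HasSum (fun j => step r₀ p₀ p q μ j * v j) s := by
  rw [hasSum_iff_tendsto_nat_of_nonneg
    (fun j => mul_nonneg (step_nonneg hr₀ hp₀ hp hq hμ j) (hv j).1),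
    ← tendsto_add_atTop_iff_nat 1]
  simp only [sum_step_mul]
  have hbdd : ∀ (a : ℕ → ℕ) {f : ℕ → ℝ}, Tendsto f atTop (𝓝 0) →
      Tendsto (fun N => f N * v (a N)) atTop (𝓝 0) := by
    intro a f hf
    refine hf.zero_mul_isBoundedUnder_le ⟨1, eventually_map.mpr (.of_forall fun N => ?_)⟩
    simp only [Function.comp_apply, Real.norm_eq_abs]
    exact abs_le.mpr ⟨by linarith [(hv (a N)).1], (hv (a N)).2⟩
  have h1 := (tendsto_add_atTop_iff_nat 1).mpr hs.tendsto_sum_nat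
  have h2 := hbdd id (((tendsto_add_atTop_iff_nat 1).mpr hμ0).const_mul q |>.trans (by simp))
  have h3 := hbdd (· + 1) (tendsto_up_mul (p₀ := p₀) (p := p) hμ0)
  simpa using h1.add (h2.sub h3)

theorem hasSum_step (hr₀ : 0 ≤ r₀) (hp₀ : 0 < p₀) (hp : 0 < p) (hq : 0 < q) (hpq : p + q = 1)
    {μ : ℕ → ℝ} (hμ : ∀ j, 0 ≤ μ j) {s : ℝ} (hs : HasSum μ s) :
    HasSum (step r₀ p₀ p q μ) (s - (1 - r₀ - p₀) * μ 0) := by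
  have h1 : HasSum (fun j => μ j * act r₀ p₀ p q (fun _ => 1) j) (s - (1 - r₀ - p₀) * μ 0) := by
    have h2 := hs.sub (hasSum_ite_eq 0 ((1 - r₀ - p₀) * μ 0))
    refine h2.congr_fun fun j => ?_
    rw [act_one _ _ hpq]
    split_ifs with h
    · subst h; ring
    · ring
  simpa using hasSum_step_mul hr₀ hp₀ hp hq hμ hs.summable.tendsto_atTop_zero
    (fun _ => ⟨zero_le_one, le_rfl⟩) h1

theorem law_nonneg_and_hasSum (hr₀ : 0 ≤ r₀) (hp₀ : 0 < p₀) (hp : 0 < p) (hq : 0 < q)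
    (hpq : p + q = 1) {α : ℕ → ℝ} (hα : IsDistribution α) (n : ℕ) :
    (∀ j, 0 ≤ law r₀ p₀ p q α n (some j)) ∧
      HasSum (fun j => law r₀ p₀ p q α n (some j)) (1 - law r₀ p₀ p q α n none) := by
  induction n with
  | zero => simpa [law, IsDistribution] using hα
  | succ n ih =>
    simp only [law_succ_some, law_succ_none]
    refine ⟨step_nonneg hr₀ hp₀ hp hq ih.1, ?_⟩
    convert hasSum_step hr₀ hp₀ hp hq hpq ih.1 ih.2 using 1
    ring

/-- The probability of surviving up to time `n`, as a function of the initial state. -/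
noncomputable def survival (r₀ p₀ p q : ℝ) : ℕ → ℕ → ℝ
  | 0 => fun _ => 1
  | n + 1 => act r₀ p₀ p q (survival r₀ p₀ p q n)

theorem act_mono (hr₀ : 0 ≤ r₀) (hp₀ : 0 < p₀) (hp : 0 < p) (hq : 0 < q) {v w : ℕ → ℝ}
    (h : ∀ j, v j ≤ w j) (j : ℕ) : act r₀ p₀ p q v j ≤ act r₀ p₀ p q w j := by
  cases j with
  | zero =>
    exact add_le_add (mul_le_mul_of_nonneg_left (h _) hr₀) (mul_le_mul_of_nonneg_left (h _) hp₀.le)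
  | succ j =>
    exact add_le_add (mul_le_mul_of_nonneg_left (h _) hq.le) (mul_le_mul_of_nonneg_left (h _) hp.le)

theorem survival_succ_le (hr₀ : 0 ≤ r₀) (hp₀ : 0 < p₀) (hp : 0 < p) (hq : 0 < q)
    (hpq : p + q = 1) (hq₀ : 0 < 1 - r₀ - p₀) (n j : ℕ) :
    survival r₀ p₀ p q (n + 1) j ≤ survival r₀ p₀ p q n j := by
  induction n generalizing j with
  | zero =>
    simp only [survival]
    rw [act_one _ _ hpq]
    split_ifs <;> linarith
  | succ n ih => exact act_mono hr₀ hp₀ hp hq ih j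

theorem survival_mem_Icc (hr₀ : 0 ≤ r₀) (hp₀ : 0 < p₀) (hp : 0 < p) (hq : 0 < q)
    (hpq : p + q = 1) (hq₀ : 0 < 1 - r₀ - p₀) (n j : ℕ) :
    survival r₀ p₀ p q n j ∈ Set.Icc (0 : ℝ) 1 := by
  induction n generalizing j with
  | zero => simp [survival]
  | succ n ih =>
    refine ⟨?_, (survival_succ_le hr₀ hp₀ hp hq hpq hq₀ n j).trans (ih j).2⟩
    have := act_mono hr₀ hp₀ hp hq (v := fun _ => 0) (fun j => (ih j).1) j
    refine le_trans (le_of_eq ?_) this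
    cases j <;> simp [act]

theorem eq_mul_eval_qPoly_of_act_eq (hp₀ : 0 < p₀) (hp : 0 < p) {u : ℕ → ℝ} {x : ℝ}
    (h : ∀ j, act r₀ p₀ p q u j = x * u j) (n : ℕ) :
    u n = u 0 * (qPoly r₀ p₀ p q n).eval x := by
  induction n using Nat.twoStepInduction with
  | zero => rw [eval_qPoly_zero, mul_one]
  | one =>
    apply mul_left_cancel₀ hp₀.ne'
    have h1 := mul_eval_qPoly_one r₀ (p := p) q x hp₀
    have h2 := h 0
    simp only [act] at h2
    linear_combination h2 - u 0 * h1
  | more n ih0 ih1 =>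
    apply mul_left_cancel₀ hp.ne'
    have h1 := mul_eval_qPoly_add_two r₀ (p₀ := p₀) q x hp n
    have h2 := h (n + 1)
    simp only [act] at h2
    linear_combination h2 - u 0 * h1 - q * ih0 + x * ih1

/-- Survival probabilities decrease to some u with ℙu = u, so u_n = u_0 Q_n(1). Since u ≤ 1 while
Q_n(1) grows at least linearly, u_0 = 0. -/
theorem tendsto_survival (hr₀ : 0 ≤ r₀) (hp₀ : 0 < p₀) (hp : 0 < p) (hq : 0 < q)
    (hpq : p + q = 1) (hq₀ : 0 < 1 - r₀ - p₀) (hp_half : p ≤ 1 / 2) (j : ℕ) :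
    Tendsto (fun n => survival r₀ p₀ p q n j) atTop (𝓝 0) := by
  have hmem := survival_mem_Icc hr₀ hp₀ hp hq hpq hq₀
  have hlim : ∀ j, ∃ u, Tendsto (fun n => survival r₀ p₀ p q n j) atTop (𝓝 u) := fun j =>
    ⟨_, tendsto_atTop_ciInf
      (antitone_nat_of_succ_le fun n => survival_succ_le hr₀ hp₀ hp hq hpq hq₀ n j)
      ⟨0, by rintro _ ⟨n, rfl⟩; exact (hmem n j).1⟩⟩
  choose u hu using hlim
  have hu1 : ∀ j, u j ≤ 1 := fun j => le_of_tendsto' (hu j) fun n => (hmem n j).2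
  have hu0 : 0 ≤ u 0 := ge_of_tendsto' (hu 0) fun n => (hmem n 0).1
  have hfix : ∀ j, act r₀ p₀ p q u j = 1 * u j := by
    intro j
    rw [one_mul]
    refine tendsto_nhds_unique ?_ ((tendsto_add_atTop_iff_nat 1).mpr (hu j))
    cases j with
    | zero => exact ((hu 0).const_mul r₀).add ((hu 1).const_mul p₀)
    | succ j => exact ((hu j).const_mul q).add ((hu (j + 2)).const_mul p)
  have hQ := eq_mul_eval_qPoly_of_act_eq hp₀ hp hfix
  have h0 : u 0 = 0 := by
    by_contra hne
    have hpos : 0 < u 0 := lt_of_le_of_ne hu0 (Ne.symm hne)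
    have hd : 0 < (1 - r₀ - p₀) / p₀ := div_pos hq₀ hp₀
    obtain ⟨n, hn⟩ := exists_nat_gt (1 / u 0 / ((1 - r₀ - p₀) / p₀))
    rw [div_lt_iff₀ hd, div_lt_iff₀ hpos] at hn
    have h1 := one_add_mul_le_eval_qPoly_one hp₀ hp hpq hq₀ hp_half n
    have h2 := mul_le_mul_of_nonneg_left h1 hu0
    rw [← hQ n] at h2
    linarith [hu1 n]
  have := hu j
  rwa [hQ j, h0, zero_mul] at this

/-- Duality moves n steps from the survival function onto the distribution; k = 0 expresses the
surviving mass through the initial distribution. -/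
theorem hasSum_law_mul_survival (hr₀ : 0 ≤ r₀) (hp₀ : 0 < p₀) (hp : 0 < p) (hq : 0 < q)
    (hpq : p + q = 1) (hq₀ : 0 < 1 - r₀ - p₀) {α : ℕ → ℝ} (hα : IsDistribution α) (n k : ℕ) {s : ℝ}
    (hs : HasSum (fun j => α j * survival r₀ p₀ p q (n + k) j) s) :
    HasSum (fun j => law r₀ p₀ p q α n (some j) * survival r₀ p₀ p q k j) s := by
  induction n generalizing k with
  | zero => simpa [law] using hs
  | succ n ih =>
    have hl := law_nonneg_and_hasSum hr₀ hp₀ hp hq hpq hα n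
    simp only [law_succ_some]
    refine hasSum_step_mul hr₀ hp₀ hp hq hl.1 hl.2.summable.tendsto_atTop_zero
      (survival_mem_Icc hr₀ hp₀ hp hq hpq hq₀ k) ?_
    exact ih (k + 1) (by rwa [show n + (k + 1) = n + 1 + k by omega])

theorem tendsto_law_none (hr₀ : 0 ≤ r₀) (hp₀ : 0 < p₀) (hp : 0 < p) (hq : 0 < q)
    (hpq : p + q = 1) (hq₀ : 0 < 1 - r₀ - p₀) (hp_half : p ≤ 1 / 2) {α : ℕ → ℝ}
    (hα : IsDistribution α) : Tendsto (fun n => law r₀ p₀ p q α n none) atTop (𝓝 1) := by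
  have hmem := survival_mem_Icc hr₀ hp₀ hp hq hpq hq₀
  have hle : ∀ n j, ‖α j * survival r₀ p₀ p q n j‖ ≤ α j := fun n j => by
    rw [Real.norm_of_nonneg (mul_nonneg (hα.1 j) (hmem n j).1)]
    exact mul_le_of_le_one_right (hα.1 j) (hmem n j).2
  have h1 : Tendsto (fun n => ∑' j, α j * survival r₀ p₀ p q n j) atTop (𝓝 (∑' _ : ℕ, (0 : ℝ))) := by
    refine tendsto_tsum_of_dominated_convergence hα.2.summable (fun j => ?_) (.of_forall hle)
    simpa using (tendsto_survival hr₀ hp₀ hp hq hpq hq₀ hp_half j).const_mul (α j)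
  have h2 : ∀ n, law r₀ p₀ p q α n none = 1 - ∑' j, α j * survival r₀ p₀ p q n j := by
    intro n
    have hs : Summable fun j => α j * survival r₀ p₀ p q n j :=
      hα.2.summable.of_norm_bounded (hle n)
    have h3 := hasSum_law_mul_survival hr₀ hp₀ hp hq hpq hq₀ hα n 0 hs.hasSum
    simp only [survival, mul_one] at h3
    have h4 := h3.unique (law_nonneg_and_hasSum hr₀ hp₀ hp hq hpq hα n).2
    rw [h4]
    ring
  simp only [h2]
  simpa using h1.const_sub 1

end walk

/-! ### Left eigenvectors and quasi-stationary distributions -/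

section quasiStationary
variable {r₀ p₀ p q : ℝ}

theorem family_eq_eval (hp₀ : 0 < p₀) (hp : 0 < p) (hq : 0 < q) (x : ℝ) (j : ℕ) :
    family r₀ p₀ p q x j = (1 - x) / (1 - r₀ - p₀) *
      (weight p₀ p q j * (qPoly r₀ p₀ p q j).eval x) := by
  rw [family, eigenfun_eq_eval _ hp₀ hp hq]
  ring

theorem family_zero (hp₀ : 0 < p₀) (hp : 0 < p) (hq : 0 < q) (x : ℝ) :
    family r₀ p₀ p q x 0 = (1 - x) / (1 - r₀ - p₀) := by
  rw [family_eq_eval hp₀ hp hq, eval_qPoly_zero]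
  simp [weight]

theorem step_family (hp₀ : 0 < p₀) (hp : 0 < p) (hq : 0 < q) (x : ℝ) (j : ℕ) :
    step r₀ p₀ p q (family r₀ p₀ p q x) j = x * family r₀ p₀ p q x j := by
  have hw := weight_succ_mul (p₀ := p₀) (p := p) hq
  cases j with
  | zero =>
    have h1 := mul_eval_qPoly_one r₀ (p := p) q x hp₀
    have h0 := hw 0
    simp only [step, family_eq_eval hp₀ hp hq, eval_qPoly_zero]
    simp only [weight, up] at h0 ⊢
    simp only [zero_add] at h0
    linear_combination (1 - x) / (1 - r₀ - p₀) * (qPoly r₀ p₀ p q 1).eval x * h0 +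
      (1 - x) / (1 - r₀ - p₀) * h1
  | succ j =>
    have h1 := mul_eval_qPoly_add_two r₀ (p₀ := p₀) q x hp j
    have h2 := hw j
    have h3 := hw (j + 1)
    rw [show up p₀ p (j + 1) = p from rfl] at h3
    simp only [step, family_eq_eval hp₀ hp hq]
    linear_combination (1 - x) / (1 - r₀ - p₀) *
      (weight p₀ p q (j + 1) * h1 - (qPoly r₀ p₀ p q j).eval x * h2 +
        (qPoly r₀ p₀ p q (j + 2)).eval x * h3)

/-- Since q ≠ 0, the left eigenvector equation determines α successively from α 0; detailed balance
turns it into the recurrence of the Q_n. -/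
theorem eq_weight_mul_of_step_eq (hp₀ : 0 < p₀) (hp : 0 < p) (hq : 0 < q) {α : ℕ → ℝ} {x : ℝ}
    (h : ∀ j, step r₀ p₀ p q α j = x * α j) (n : ℕ) :
    α n = α 0 * (weight p₀ p q n * (qPoly r₀ p₀ p q n).eval x) := by
  have hw := weight_succ_mul (p₀ := p₀) (p := p) hq
  induction n using Nat.twoStepInduction with
  | zero => simp [eval_qPoly_zero, weight]
  | one =>
    apply mul_left_cancel₀ hq.ne'
    have h1 := mul_eval_qPoly_one r₀ (p := p) q x hp₀
    have h2 := h 0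
    have h0 := hw 0
    simp only [step] at h2
    simp only [up, zero_add] at h0
    rw [show weight p₀ p q 0 = 1 from rfl] at h0
    linear_combination h2 - α 0 * h1 - α 0 * (qPoly r₀ p₀ p q 1).eval x * h0
  | more n ih0 ih1 =>
    apply mul_left_cancel₀ hq.ne'
    have h1 := mul_eval_qPoly_add_two r₀ (p₀ := p₀) q x hp n
    have h2 := h (n + 1)
    have h3 := hw n
    have h4 := hw (n + 1)
    rw [show up p₀ p (n + 1) = p from rfl] at h4
    simp only [step] at h2
    linear_combination h2 - up p₀ p n * ih0 + x * ih1
      - α 0 * weight p₀ p q (n + 1) * h1 + α 0 * (qPoly r₀ p₀ p q n).eval x * h3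
      - α 0 * (qPoly r₀ p₀ p q (n + 2)).eval x * h4

/-- Summing the eigenvector equation up to N, (1 - x) times the excess of the partial sum over 1
equals the flux up(N)α_N - qα_{N+1}. A partial sum above 1 would, as p ≤ q, make pα_N fall by a
fixed amount at each later step. So α is summable, the flux tends to 0, and the sum is 1. -/
theorem hasSum_one_of_step_eq (hp : 0 < p) (hpq : p + q = 1) (hp_half : p ≤ 1 / 2)
    {α : ℕ → ℝ} (hα : ∀ j, 0 ≤ α j) {x : ℝ} (hx : x < 1)
    (h : ∀ j, step r₀ p₀ p q α j = x * α j) (h0 : (1 - r₀ - p₀) * α 0 = 1 - x) : HasSum α 1 := by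
  have hS : ∀ N, (1 - x) * (∑ j ∈ Finset.range (N + 1), α j - 1) =
      up p₀ p N * α N - q * α (N + 1) := by
    intro N
    have h1 := sum_step_mul r₀ p₀ p q α (fun _ => 1) N
    have h2 : ∑ j ∈ Finset.range (N + 1), α j * act r₀ p₀ p q (fun _ => 1) j =
        ∑ j ∈ Finset.range (N + 1), α j - (1 - r₀ - p₀) * α 0 := by
      simp only [act_one r₀ p₀ hpq, mul_sub, mul_one, Finset.sum_sub_distrib, mul_ite, mul_zero]
      rw [Finset.sum_ite_eq' _ 0, if_pos (Finset.mem_range.mpr N.succ_pos)]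
      ring
    rw [h2, h0] at h1
    simp only [h, mul_one, ← Finset.mul_sum] at h1
    linear_combination -h1
  have hle : ∀ K, ∑ j ∈ Finset.range K, α j ≤ 1 := by
    intro K
    by_contra! hK
    set ε := (1 - x) * (∑ j ∈ Finset.range K, α j - 1) with hε
    have hε0 : 0 < ε := mul_pos (by linarith) (by linarith)
    -- Starting at K + 1 ensures that the upward probability is p even when K = 0.
    have hstep : ∀ k, p * α (K + 1 + k + 1) ≤ p * α (K + 1 + k) - ε := by
      intro k
      have h1 := hS (K + 1 + k)
      rw [show up p₀ p (K + 1 + k) = p by rw [show K + 1 + k = K + k + 1 by omega]; rfl] at h1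
      have h2 : ∑ j ∈ Finset.range K, α j ≤ ∑ j ∈ Finset.range (K + 1 + k + 1), α j :=
        Finset.sum_le_sum_of_subset_of_nonneg
          (Finset.range_subset_range.mpr (by omega)) fun j _ _ => hα j
      have h3 : ε ≤ (1 - x) * (∑ j ∈ Finset.range (K + 1 + k + 1), α j - 1) :=
        mul_le_mul_of_nonneg_left (by linarith) (by linarith)
      have h4 : p * α (K + 1 + k + 1) ≤ q * α (K + 1 + k + 1) :=
        mul_le_mul_of_nonneg_right (by linarith) (hα _)
      linarith
    have hlin : ∀ k : ℕ, p * α (K + 1 + k) ≤ p * α (K + 1) - k * ε := by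
      intro k
      induction k with
      | zero => simp
      | succ k ih =>
        have := hstep k
        push_cast
        change p * α (K + 1 + k + 1) ≤ _
        linarith
    obtain ⟨k, hk⟩ := exists_nat_gt (p * α (K + 1) / ε)
    rw [div_lt_iff₀ hε0] at hk
    linarith [hlin k, mul_nonneg hp.le (hα (K + 1 + k))]
  have hsum : Summable α := summable_of_sum_range_le hα hle
  have h0' := hsum.tendsto_atTop_zero
  rw [hasSum_iff_tendsto_nat_of_nonneg hα, ← tendsto_add_atTop_iff_nat 1]
  have h1 : ∀ N, ∑ j ∈ Finset.range (N + 1), α j =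
      1 + (1 - x)⁻¹ * (up p₀ p N * α N - q * α (N + 1)) := by
    intro N
    have hx' : 1 - x ≠ 0 := by linarith
    rw [← hS, inv_mul_cancel_left₀ hx']
    ring
  simp only [h1]
  have h2 := (tendsto_up_mul (p₀ := p₀) (p := p) h0').sub
    (((tendsto_add_atTop_iff_nat 1).mpr h0').const_mul q)
  simpa using (h2.const_mul (1 - x)⁻¹).const_add 1

theorem isQuasiStationary_family (hp₀ : 0 < p₀) (hp : 0 < p)
    (hq : 0 < q) (hpq : p + q = 1) (hq₀ : 0 < 1 - r₀ - p₀) (hp_half : p ≤ 1 / 2) {x : ℝ}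
    (hx : x < 1) (hpos : ∀ n, 0 < (qPoly r₀ p₀ p q n).eval x) :
    IsQuasiStationary r₀ p₀ p q (family r₀ p₀ p q x) := by
  -- The recurrence gives x Q_1 = q Q_0 + p Q_2 > 0 with Q_1 > 0. Positivity of x is needed because
  -- x^n will be the survival probability.
  have hx0 : 0 < x := by
    have h1 := mul_eval_qPoly_add_two r₀ (p₀ := p₀) q x hp 0
    have h2 := mul_pos hp (hpos 2)
    have h3 := mul_pos hq (hpos 0)
    exact (pos_iff_pos_of_mul_pos (a := x) (b := (qPoly r₀ p₀ p q 1).eval x)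
      (by simp only [zero_add] at h1; linarith)).mpr (hpos 1)
  have hfam0 : (1 - r₀ - p₀) * family r₀ p₀ p q x 0 = 1 - x := by
    rw [family_zero hp₀ hp hq, mul_div_cancel₀ _ hq₀.ne']
  have hnn : ∀ j, 0 ≤ family r₀ p₀ p q x j := fun j => by
    rw [family_eq_eval hp₀ hp hq]
    exact mul_nonneg (div_nonneg (by linarith) hq₀.le)
      (mul_pos (weight_pos hp₀ hp hq j) (hpos j)).le
  have hstep := step_family (r₀ := r₀) hp₀ hp hq x
  have hlaw : ∀ n, law r₀ p₀ p q (family r₀ p₀ p q x) n none = 1 - x ^ n ∧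
      ∀ j, law r₀ p₀ p q (family r₀ p₀ p q x) n (some j) = x ^ n * family r₀ p₀ p q x j := by
    intro n
    induction n with
    | zero => simp [law]
    | succ n ih =>
      refine ⟨?_, fun j => ?_⟩
      · rw [law_succ_none, ih.1, ih.2]
        linear_combination x ^ n * hfam0
      · rw [law_succ_some]
        simp only [ih.2]
        rw [pow_succ, mul_assoc, ← hstep]
        cases j <;> simp only [step] <;> ring
  refine ⟨⟨hnn, hasSum_one_of_step_eq hp hpq hp_half hnn hx hstep hfam0⟩, fun n => ?_⟩
  have hxn : 0 < x ^ n := pow_pos hx0 n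
  rw [(hlaw n).1]
  refine ⟨by linarith, fun j => ?_⟩
  rw [(hlaw n).2, sub_sub_cancel, mul_div_cancel_left₀ _ hxn.ne']

/-- Time n = 1 is enough: it says that α is a left eigenvector whose eigenvalue x is the one-step
survival probability 1 - q₀α₀. This relation also fixes α₀ as (1 - x)/q₀. -/
theorem IsQuasiStationary.exists_eq_family (hp₀ : 0 < p₀) (hp : 0 < p)
    (hq : 0 < q) (hq₀ : 0 < 1 - r₀ - p₀) {α : ℕ → ℝ}
    (hα : IsQuasiStationary r₀ p₀ p q α) :
    ∃ x < 1, (∀ n, 0 < (qPoly r₀ p₀ p q n).eval x) ∧ α = family r₀ p₀ p q x := by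
  obtain ⟨⟨hnn, hsum⟩, hqs⟩ := hα
  set x := 1 - (1 - r₀ - p₀) * α 0 with hx
  have h1 := hqs 1
  have hnone : law r₀ p₀ p q α 1 none = 1 - x := by
    rw [law_succ_none]
    simp only [law]
    ring
  have hsome : ∀ j, law r₀ p₀ p q α 1 (some j) = step r₀ p₀ p q α j := by
    intro j
    rw [law_succ_some]
    rfl
  rw [hnone] at h1
  have hx0 : 0 < x := by linarith [h1.1]
  have hstep : ∀ j, step r₀ p₀ p q α j = x * α j := by
    intro j
    have := h1.2 j
    rw [hsome, sub_sub_cancel, div_eq_iff hx0.ne'] at this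
    rw [this, mul_comm]
  have hrep := eq_weight_mul_of_step_eq hp₀ hp hq hstep
  -- All α n are multiples of α 0, so α 0 = 0 would contradict total mass 1.
  have hα0 : 0 < α 0 := by
    refine (hnn 0).lt_of_ne fun h0 => ?_
    have hz : α = fun _ => 0 := by
      funext n
      rw [hrep, ← h0, zero_mul]
    rw [hz] at hsum
    exact zero_ne_one (hasSum_zero.unique hsum)
  refine ⟨x, by linarith [mul_pos hq₀ hα0], eval_qPoly_pos_of_nonneg hp hq fun n => ?_, ?_⟩
  · have h2 := hnn n
    rw [hrep n] at h2
    exact nonneg_of_mul_nonneg_right (nonneg_of_mul_nonneg_right h2 hα0) (weight_pos hp₀ hp hq n)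
  · funext n
    rw [hrep n, family_eq_eval hp₀ hp hq, hx, sub_sub_cancel, mul_div_cancel_left₀ _ hq₀.ne']

theorem family_injective (hp₀ : 0 < p₀) (hp : 0 < p) (hq : 0 < q) (hq₀ : 0 < 1 - r₀ - p₀) :
    Function.Injective (family r₀ p₀ p q) := by
  intro x y h
  have h0 := congrFun h 0
  rw [family_zero hp₀ hp hq, family_zero hp₀ hp hq, div_left_inj' hq₀.ne'] at h0
  linarith

theorem hasSum_transition_mul_eigenfun (hp₀ : 0 < p₀) (hp : 0 < p) (hq : 0 < q) (x : ℝ) (i : ℕ) :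
    HasSum (fun j => transition r₀ p₀ p q i j * eigenfun r₀ p₀ p q j x)
      (x * eigenfun r₀ p₀ p q i x) := by
  simp only [eigenfun_eq_eval r₀ hp₀ hp hq]
  cases i with
  | zero =>
    have h1 := mul_eval_qPoly_one r₀ (p := p) q x hp₀
    have : x * (qPoly r₀ p₀ p q 0).eval x = ∑ j ∈ ({0, 1} : Finset ℕ),
        transition r₀ p₀ p q 0 j * (qPoly r₀ p₀ p q j).eval x := by
      rw [Finset.sum_pair (by simp)]
      simp only [transition, eval_qPoly_zero]
      simp [h1]
    rw [this]
    refine hasSum_sum_of_ne_finset_zero fun j hj => ?_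
    simp only [Finset.mem_insert, Finset.mem_singleton, not_or] at hj
    simp [transition, hj]
  | succ i =>
    have h1 := mul_eval_qPoly_add_two r₀ (p₀ := p₀) q x hp i
    have : x * (qPoly r₀ p₀ p q (i + 1)).eval x = ∑ j ∈ ({i, i + 2} : Finset ℕ),
        transition r₀ p₀ p q (i + 1) j * (qPoly r₀ p₀ p q j).eval x := by
      rw [Finset.sum_pair (by simp)]
      simp [transition, h1]
    rw [this]
    refine hasSum_sum_of_ne_finset_zero fun j hj => ?_
    simp only [Finset.mem_insert, Finset.mem_singleton, not_or] at hj
    simp [transition, hj]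

end quasiStationary

end KarlinMcGregor

/-! ### Conclusion -/

theorem mainTheorem3 (r₀ p₀ p q : ℝ) (hr₀ : 0 ≤ r₀) (hp₀ : 0 < p₀) (hp : 0 < p) (hq : 0 < q)
    (hpq : p + q = 1) (hq₀ : 0 < 1 - r₀ - p₀) (hp_half : p ≤ 1 / 2) :
    -- absorption is certain
    (∀ α : ℕ → ℝ, IsDistribution α →
      Tendsto (fun n => law r₀ p₀ p q α n none) atTop (𝓝 1)) ∧
    -- the functions `Q_j` are the eigenfunctions of the transition matrix with `Q_0 = 1`
    (∀ x : ℝ, eigenfun r₀ p₀ p q 0 x = 1 ∧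
      ∀ i : ℕ, HasSum (fun j => transition r₀ p₀ p q i j * eigenfun r₀ p₀ p q j x)
        (x * eigenfun r₀ p₀ p q i x)) ∧
    ∃ (ψ : Measure ℝ) (η : ℝ),
      -- the orthogonality measure, and the supremum of its support
      IsOrthogonalityMeasure r₀ p₀ p q ψ ∧
      (∀ ψ' : Measure ℝ, IsOrthogonalityMeasure r₀ p₀ p q ψ' → ψ' = ψ) ∧
      IsLUB ψ.support η ∧
      (p = 1 / 2 → η = 1 ∧ ¬ ∃ α : ℕ → ℝ, IsQuasiStationary r₀ p₀ p q α) ∧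
      (p < 1 / 2 → η < 1 ∧
        (∀ x ∈ Set.Ioo η 1, IsQuasiStationary r₀ p₀ p q (family r₀ p₀ p q x)) ∧
        Set.InjOn (family r₀ p₀ p q) (Set.Ico η 1) ∧
        ∀ α : ℕ → ℝ, IsQuasiStationary r₀ p₀ p q α ↔
          ∃ x ∈ Set.Ico η 1, α = family r₀ p₀ p q x) := by
  obtain ⟨ψ, hψ⟩ := exists_isOrthogonalityMeasure hr₀ hp₀ hp hq hpq hq₀
  obtain ⟨η, hlub, hη1, hpos, hmin⟩ := hψ.exists_isLUB_support hr₀ hp₀ hp hq hpq hq₀ hp_half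
  refine ⟨fun α hα => tendsto_law_none hr₀ hp₀ hp hq hpq hq₀ hp_half hα,
    fun x => ⟨by rw [eigenfun_eq_eval r₀ hp₀ hp hq, eval_qPoly_zero],
      hasSum_transition_mul_eigenfun hp₀ hp hq x⟩,
    ψ, η, hψ, fun ψ' hψ' => hψ.unique hp₀ hp hq hψ', hlub, fun hhalf => ?_, fun hlt => ?_⟩
  · have hneg : ∀ x < 1, ¬ ∀ n, 0 < (qPoly r₀ p₀ p q n).eval x := fun x hx h =>
      not_forall_eval_qPoly_nonneg hp (by linarith) hpq hx fun n => (h n).le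
    refine ⟨hη1.antisymm (not_lt.mp fun h => hneg η h (hpos η le_rfl hη1)), ?_⟩
    rintro ⟨α, hα⟩
    obtain ⟨x, hx, hQ, -⟩ := hα.exists_eq_family hp₀ hp hq hq₀
    exact hneg x hx hQ
  · have hfam : ∀ x ∈ Set.Ico η 1, IsQuasiStationary r₀ p₀ p q (family r₀ p₀ p q x) :=
      fun x hx => isQuasiStationary_family hp₀ hp hq hpq hq₀ hp_half hx.2 (hpos x hx.1 hx.2.le)
    obtain ⟨y, hy, hQ⟩ := exists_lt_one_forall_eval_qPoly_pos (q := q) hp₀ hp hpq hq₀ hlt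
    refine ⟨(hmin y hQ).trans_lt hy, fun x hx => hfam x ⟨hx.1.le, hx.2⟩,
      (family_injective hp₀ hp hq hq₀).injOn, fun α => ⟨fun hα => ?_, ?_⟩⟩
    · obtain ⟨x, hx, hQx, rfl⟩ := hα.exists_eq_family hp₀ hp hq hq₀
      exact ⟨x, ⟨hmin x hQx, hx⟩, rfl⟩
    · rintro ⟨x, hx, rfl⟩
      exact hfam x hx
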